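/- **Theorem 1.4.** Let $\Omega\subset\mathbb R^n$ be a bounded convex open set with smooth ($C^\infty$) boundary and outward unit normal $n$ on $\partial\Omega$. Let $\lambda>0$, $P\ge 0$, $0<T<\infty$. Let $f\in C^2(\overline\Omega)$ satisfy $f\ge c_0$ on $\overline\Omega$ for some constant $c_0>0$, and $\frac{\partial f}{\partial n}\le 0$ on $\partial\Omega$. Let $u_0\in C^2(\overline\Omega)$ satisfy $u_0\ge 0$ and $$\Delta u_0+\frac{\lambda f}{(1-u_0)^2}+P\ge 0\quad\text{in }\Omega .$$ Let $u<1$ be a classical solution, that is $u\in C(\overline\Omega\times[0,T))\cap C^{2,1}(\overline\Omega\times(0,T))$, of $$u_t-\Delta u=\frac{\lambda f(x)}{(1-u)^2}+P\ \text{ in }\Omega\times(0,T),\qquad u=0\ \text{ on }\partial\Omega\times(0,T),\qquad u(\cdot,0)=u_0\ \text{ in }\Omega,$$ which quenches at the finite time $T$, that is $\limsup_{t\to T^-}\sup_{x\in\Omega}u(x,t)=1$. Then the quenching set $$\Sigma=\{x\in\overline\Omega:\ \exists\,(x_k,t_k)\in\Omega\times(0,T)\text{ with }x_k\to x,\ t_k\to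 T,\ u(x_k,t_k)\to 1\}$$ is a compact subset of $\Omega$; in particular, no point of $\partial\Omega$ is a quenching point. -/

import Mathlib

open Set Filter Topology
open scoped ContDiff

namespace MEMS

/-- `ρ` is a smooth defining function of the set `Ω` near the point `y`: close to `y`, the set `Ω`
is `{ρ < 0}`, and the gradient of `ρ` at `y` does not vanish. -/
structure IsDefiningFunctionAt {n : ℕ} (Ω : Set (EuclideanSpace ℝ (Fin n)))
    (y : EuclideanSpace ℝ (Fin n)) (ρ : EuclideanSpace ℝ (Fin n) → ℝ) : Prop where
  smooth : ContDiff ℝ ∞ ρ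
  mem_iff : ∀ᶠ x in 𝓝 y, x ∈ Ω ↔ ρ x < 0
  gradient_ne_zero : gradient ρ y ≠ 0

/-- The boundary of `Ω` is smooth (of class `C^∞`), with `Ω` locally on one side of it. -/
def HasSmoothBoundary {n : ℕ} (Ω : Set (EuclideanSpace ℝ (Fin n))) : Prop :=
  ∀ y ∈ frontier Ω, ∃ ρ, IsDefiningFunctionAt Ω y ρ

/-- `ν` is the outward unit normal of `Ω` at the boundary point `y`. -/
def IsOutwardUnitNormal {n : ℕ} (Ω : Set (EuclideanSpace ℝ (Fin n)))
    (y ν : EuclideanSpace ℝ (Fin n)) : Prop :=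
  ∃ ρ, IsDefiningFunctionAt Ω y ρ ∧ ν = ‖gradient ρ y‖⁻¹ • gradient ρ y

/-- `u` is a classical solution, with values below `1`, of
`u_t - Δ u = lam * f / (1 - u) ^ 2 + P` in `Ω × (0, T)`, `u = 0` on `∂Ω × (0, T)`,
`u(·, 0) = u₀` in `Ω`: it is continuous on `closure Ω × [0, T)` and of class `C^{2,1}` on
`closure Ω × (0, T)`. -/
structure IsClassicalSolution {n : ℕ} (Ω : Set (EuclideanSpace ℝ (Fin n))) (lam P : ℝ)
    (f u₀ : EuclideanSpace ℝ (Fin n) → ℝ) (T : ℝ)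
    (u : EuclideanSpace ℝ (Fin n) → ℝ → ℝ) : Prop where
  continuousOn : ContinuousOn (fun p : EuclideanSpace ℝ (Fin n) × ℝ => u p.1 p.2)
    (closure Ω ×ˢ Ico 0 T)
  contDiffOn_space : ∀ t ∈ Ioo 0 T, ContDiffOn ℝ 2 (fun x => u x t) (closure Ω)
  continuousOn_space_deriv : ∀ k : ℕ, k ≤ 2 →
    ContinuousOn (fun p : EuclideanSpace ℝ (Fin n) × ℝ =>
      iteratedFDerivWithin ℝ k (fun x => u x p.2) (closure Ω) p.1) (closure Ω ×ˢ Ioo 0 T)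
  differentiableAt_time : ∀ x ∈ closure Ω, ∀ t ∈ Ioo 0 T, DifferentiableAt ℝ (u x) t
  continuousOn_time_deriv : ContinuousOn
    (fun p : EuclideanSpace ℝ (Fin n) × ℝ => deriv (u p.1) p.2) (closure Ω ×ˢ Ioo 0 T)
  lt_one : ∀ x ∈ closure Ω, ∀ t ∈ Ico 0 T, u x t < 1
  equation : ∀ x ∈ Ω, ∀ t ∈ Ioo 0 T,
    deriv (u x) t - Laplacian.laplacian (fun z => u z t) x = lam * f x / (1 - u x t) ^ 2 + P
  boundary : ∀ x ∈ frontier Ω, ∀ t ∈ Ioo 0 T, u x t = 0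
  initial : ∀ x ∈ Ω, u x 0 = u₀ x

/-- The function `u` on `Ω × [0, T)`, which is below `1` there, touches `1` as `t` increases to
the finite time `T`, that is `limsup_{t → T⁻} sup_Ω u(·, t) = 1`. -/
def QuenchesAt {n : ℕ} (Ω : Set (EuclideanSpace ℝ (Fin n)))
    (u : EuclideanSpace ℝ (Fin n) → ℝ → ℝ) (T : ℝ) : Prop :=
  ∀ ε > 0, ∀ s < T, ∃ t ∈ Ioo 0 T, s < t ∧ ∃ x ∈ Ω, 1 - ε < u x t

/-- The quenching set: the limits in `closure Ω` of points `x_k ∈ Ω` such that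
`u(x_k, t_k) → 1` for some times `t_k ∈ (0, T)` tending to `T`. -/
def quenchingSet {n : ℕ} (Ω : Set (EuclideanSpace ℝ (Fin n)))
    (u : EuclideanSpace ℝ (Fin n) → ℝ → ℝ) (T : ℝ) : Set (EuclideanSpace ℝ (Fin n)) :=
  {x | x ∈ closure Ω ∧ ∃ (xs : ℕ → EuclideanSpace ℝ (Fin n)) (ts : ℕ → ℝ),
    (∀ k, xs k ∈ Ω ∧ ts k ∈ Ioo 0 T) ∧ Tendsto xs atTop (𝓝 x) ∧ Tendsto ts atTop (𝓝 T) ∧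
    Tendsto (fun k => u (xs k) (ts k)) atTop (𝓝 1)}

end MEMS

/-!
The idea is to show that quenching is of type I up to the boundary, `1 - u ≥ c (T - t) ^ (1 / 3)`.
Then the right side of the equation is at most `C (T - t) ^ (-2 / 3)`, which is integrable in time,
and a solution of the heat equation with such a source, and with zero boundary values, stays small
near the boundary.

The rate comes from an inequality `u_t ≥ ε (Φ(u) - 6)` with `Φ(s) = (1 - s)⁻² + (1 - s)⁻¹`, by
integration in time. Since the initial datum is a subsolution, `u` is nondecreasing in time. In the
comparison of `u_t` with `ε (Φ(u) - D(t))` the level `D` moves from `3` to `6` on a short interval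
before `T`. As `Φ(0) = 2`, the comparison function is negative on `∂Ω`, so that no information on
`u_t` near the boundary is needed; the growth of `D` compensates the terms of the wrong sign for
moderate `u`, and the lower order term of `Φ` does so for `u` close to `1`. At the initial time of
the comparison `u_t` has to be positive on a compact subset of `Ω`, and it is, because it is
positive somewhere at an earlier time and this positivity spreads.

A classical solution is only once differentiable in time, so `u_t` is replaced by increments
`u(·, t + h) - u(·, t)`, which are supersolutions of the linearised equation because the
nonlinearity is convex (`MEMS.IsClassicalSolution.increment_supersolution`), and the estimates are
uniform in `h`. All comparisons rest on `nonneg_of_parabolic_minimum`. The three main steps are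
`le_of_heat_supersolution` (spreading of positivity, by a travelling bump, whose path lies in `Ω` by
convexity), `MEMS.IsClassicalSolution.increment_ge_profile` (the lower bound for `u_t`) and
`MEMS.IsClassicalSolution.exists_le_near_boundary` (the barrier at a supporting hyperplane).
-/

/-! ### The Laplacian at a local minimum, and the parabolic minimum principle -/

section Laplacian

variable {E : Type*} [NormedAddCommGroup E]

theorem deriv_deriv_nonneg_of_isLocalMin {g : ℝ → ℝ} {a : ℝ} (h : IsLocalMin g a)
    (hc : ContinuousAt g a) : 0 ≤ deriv (deriv g) a := by
  by_contra! hneg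
  -- A negative second derivative makes `a` a local maximum too, so `g` is locally constant.
  have hmax : IsLocalMax g a := isLocalMax_of_deriv_deriv_neg hneg h.deriv_eq_zero hc
  have hconst : g =ᶠ[𝓝 a] fun _ => g a := by
    filter_upwards [h, hmax] with x h1 h2 using le_antisymm h2 h1
  have h2 : deriv (deriv g) a = 0 := by
    rw [hconst.deriv.deriv_eq]
    simp
  exact hneg.ne h2

variable [InnerProductSpace ℝ E]

theorem iteratedFDeriv_two_eq_deriv_deriv {φ : E → ℝ} {x : E} (hφ : ContDiffAt ℝ 2 φ x) (e : E) :
    iteratedFDeriv ℝ 2 φ x ![e, e] = deriv (deriv fun τ : ℝ => φ (x + τ • e)) 0 := by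
  have hline : ∀ τ : ℝ, HasDerivAt (fun τ : ℝ => x + τ • e) e τ := fun τ => by
    simpa using ((hasDerivAt_id τ).smul_const e).const_add x
  have hd : ∀ᶠ y in 𝓝 x, DifferentiableAt ℝ φ y := by
    filter_upwards [hφ.eventually (by simp)] with y hy using hy.differentiableAt (by simp)
  have hcont : Tendsto (fun τ : ℝ => x + τ • e) (𝓝 0) (𝓝 x) := by
    simpa using (hline 0).continuousAt.tendsto
  have h1 : deriv (fun τ : ℝ => φ (x + τ • e)) =ᶠ[𝓝 0] fun τ => fderiv ℝ φ (x + τ • e) e := by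
    filter_upwards [hcont.eventually hd] with τ hτ
    exact (hτ.hasFDerivAt.comp_hasDerivAt τ (hline τ)).deriv
  have h2 : DifferentiableAt ℝ (fderiv ℝ φ) x :=
    (hφ.fderiv_right (m := 1) (by norm_num)).differentiableAt (by simp)
  have h2' : HasFDerivAt (fderiv ℝ φ) (fderiv ℝ (fderiv ℝ φ) x) (x + (0 : ℝ) • e) := by
    simpa using h2.hasFDerivAt
  have h3 : HasDerivAt (fun τ : ℝ => fderiv ℝ φ (x + τ • e)) (fderiv ℝ (fderiv ℝ φ) x e) 0 :=
    h2'.comp_hasDerivAt (0 : ℝ) (hline 0)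
  have h4 : HasDerivAt (fun τ : ℝ => fderiv ℝ φ (x + τ • e) e)
      (fderiv ℝ (fderiv ℝ φ) x e e) 0 :=
    ((ContinuousLinearMap.apply ℝ ℝ e).hasFDerivAt.comp_hasDerivAt (0 : ℝ) h3)
  rw [h1.deriv_eq, iteratedFDeriv_two_apply, h4.deriv]
  rfl

variable [FiniteDimensional ℝ E]

theorem laplacian_eq_sum_deriv_deriv {φ : E → ℝ} {x : E} (hφ : ContDiffAt ℝ 2 φ x) :
    Laplacian.laplacian φ x =
      ∑ i, deriv (deriv fun τ : ℝ => φ (x + τ • stdOrthonormalBasis ℝ E i)) 0 := by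
  rw [InnerProductSpace.laplacian_eq_iteratedFDeriv_stdOrthonormalBasis]
  exact Finset.sum_congr rfl fun i _ => iteratedFDeriv_two_eq_deriv_deriv hφ _

theorem laplacian_nonneg_of_isLocalMin {φ : E → ℝ} {x : E} (hφ : ContDiffAt ℝ 2 φ x)
    (h : IsLocalMin φ x) : 0 ≤ Laplacian.laplacian φ x := by
  rw [laplacian_eq_sum_deriv_deriv hφ]
  refine Finset.sum_nonneg fun i _ => ?_
  have hc : ContinuousAt (fun τ : ℝ => x + τ • stdOrthonormalBasis ℝ E i) 0 := by fun_prop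
  have hx : x + (0 : ℝ) • stdOrthonormalBasis ℝ E i = x := by simp
  refine deriv_deriv_nonneg_of_isLocalMin ?_ ?_
  · have := hc.tendsto
    rw [hx] at this
    filter_upwards [this.eventually h] with τ hτ
    simpa using hτ
  · exact ContinuousAt.comp (by rw [hx]; exact hφ.continuousAt) hc

theorem laplacian_le_of_isLocalMin_sub {φ ψ : E → ℝ} {x : E} (hφ : ContDiffAt ℝ 2 φ x)
    (hψ : ContDiffAt ℝ 2 ψ x) (h : IsLocalMin (fun y => φ y - ψ y) x) :
    Laplacian.laplacian ψ x ≤ Laplacian.laplacian φ x := by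
  have h1 : 0 ≤ Laplacian.laplacian (φ - ψ) x := laplacian_nonneg_of_isLocalMin (hφ.sub hψ) h
  rw [hφ.laplacian_sub hψ] at h1
  linarith

theorem laplacian_const_mul {φ : E → ℝ} {x : E} (c : ℝ) (hφ : ContDiffAt ℝ 2 φ x) :
    Laplacian.laplacian (fun y => c * φ y) x = c * Laplacian.laplacian φ x :=
  InnerProductSpace.laplacian_smul c hφ

theorem laplacian_continuousLinearMap (l : E →L[ℝ] ℝ) (x : E) :
    Laplacian.laplacian (fun y => l y) x = 0 := by
  rw [laplacian_eq_sum_deriv_deriv l.contDiff.contDiffAt]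
  refine Finset.sum_eq_zero fun i _ => ?_
  have : (deriv fun τ : ℝ => l (x + τ • stdOrthonormalBasis ℝ E i)) =
      fun _ => l (stdOrthonormalBasis ℝ E i) := by
    funext τ
    simp
  rw [this, deriv_const]

theorem laplacian_sq_sub_norm_sq_sq (R : ℝ) (ξ x : E) :
    Laplacian.laplacian (fun y : E => (R ^ 2 - ‖y - ξ‖ ^ 2) ^ 2) x =
      8 * ‖x - ξ‖ ^ 2 - 4 * Module.finrank ℝ E * (R ^ 2 - ‖x - ξ‖ ^ 2) := by
  have hC : ContDiff ℝ 2 fun y : E => (R ^ 2 - ‖y - ξ‖ ^ 2) ^ 2 :=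
    (contDiff_const.sub ((contDiff_id.sub contDiff_const).norm_sq ℝ)).pow 2
  rw [laplacian_eq_sum_deriv_deriv hC.contDiffAt]
  set b := stdOrthonormalBasis ℝ E
  set s := R ^ 2 - ‖x - ξ‖ ^ 2
  have key : ∀ i, deriv (deriv fun τ : ℝ => (R ^ 2 - ‖x + τ • b i - ξ‖ ^ 2) ^ 2) 0 =
      8 * (inner ℝ (b i) (x - ξ)) ^ 2 - 4 * s := by
    intro i
    set p := inner ℝ (b i) (x - ξ)
    have h1 : (fun τ : ℝ => (R ^ 2 - ‖x + τ • b i - ξ‖ ^ 2) ^ 2) =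
        fun τ => (s - 2 * p * τ - τ ^ 2) ^ 2 := by
      funext τ
      have hb : ‖b i‖ = 1 := b.orthonormal.1 i
      have : ‖x + τ • b i - ξ‖ ^ 2 = ‖x - ξ‖ ^ 2 + 2 * p * τ + τ ^ 2 := by
        rw [show x + τ • b i - ξ = (x - ξ) + τ • b i by abel, norm_add_sq_real, norm_smul, hb,
          inner_smul_right, real_inner_comm]
        simp only [mul_one, Real.norm_eq_abs, sq_abs, p]
        ring
      rw [this]
      simp only [s]
      ring
    have hq : ∀ τ : ℝ, HasDerivAt (fun τ => s - 2 * p * τ - τ ^ 2) (-2 * p - 2 * τ) τ := by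
      intro τ
      have h := (((hasDerivAt_id' τ).const_mul (2 * p)).const_sub s).fun_sub
        ((hasDerivAt_id' τ).fun_pow 2)
      exact h.congr_deriv (by norm_num)
    have h2 : (deriv fun τ : ℝ => (s - 2 * p * τ - τ ^ 2) ^ 2) =
        fun τ => 2 * (s - 2 * p * τ - τ ^ 2) * (-2 * p - 2 * τ) := by
      funext τ
      simpa using ((hq τ).fun_pow 2).deriv
    rw [h1, h2]
    have h3 : HasDerivAt (fun τ : ℝ => -2 * p - 2 * τ) (-2) (0 : ℝ) := by
      simpa using ((hasDerivAt_id (0 : ℝ)).const_mul 2).const_sub (-2 * p)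
    rw [(((hq 0).const_mul 2).fun_mul h3).deriv]
    ring
  rw [Finset.sum_congr rfl fun i _ => key i, Finset.sum_sub_distrib, ← Finset.mul_sum]
  have hn : ∑ i, (inner ℝ (b i) (x - ξ)) ^ 2 = ‖x - ξ‖ ^ 2 := by
    simpa [Real.norm_eq_abs, sq_abs] using b.sum_sq_norm_inner_right (x - ξ)
  rw [hn]
  simp
  ring

end Laplacian

/-- The minimum principle for parabolic problems, in a form that asks nothing of the spatial
derivatives of `z`: at a negative spatial minimum of `z` the time derivative has to exceed `M * z`,
which for a supersolution of `z_t - Δ z = c z` with `c < M` follows from `0 ≤ Δ z` there. -/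
theorem nonneg_of_parabolic_minimum {X : Type*} [TopologicalSpace X] {Ω : Set X}
    (hΩ : IsOpen Ω) (hcomp : IsCompact (closure Ω)) {a b M : ℝ} {z : X → ℝ → ℝ}
    (hz : ContinuousOn (fun p : X × ℝ => z p.1 p.2) (closure Ω ×ˢ Icc a b))
    (hinit : ∀ x ∈ closure Ω, 0 ≤ z x a)
    (hbdry : ∀ x ∈ frontier Ω, ∀ t ∈ Ioc a b, 0 ≤ z x t)
    (hmin : ∀ x ∈ Ω, ∀ t ∈ Ioc a b, z x t < 0 → IsMinOn (fun y => z y t) (closure Ω) x →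
      ∃ d, HasDerivAt (z x) d t ∧ M * z x t < d) :
    ∀ x ∈ closure Ω, ∀ t ∈ Icc a b, 0 ≤ z x t := by
  by_contra! hcon
  obtain ⟨x₁, hx₁, t₁, ht₁, hneg₁⟩ := hcon
  have hK : IsCompact (closure Ω ×ˢ Icc a b) := hcomp.prod isCompact_Icc
  have hζ : ContinuousOn (fun p : X × ℝ => Real.exp (-M * p.2) * z p.1 p.2)
      (closure Ω ×ˢ Icc a b) := ContinuousOn.mul (by fun_prop) hz
  obtain ⟨⟨x, t⟩, ⟨hx, ht⟩, hm⟩ := hK.exists_isMinOn ⟨(x₁, t₁), hx₁, ht₁⟩ hζ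
  have hm' : ∀ y ∈ closure Ω, ∀ s ∈ Icc a b,
      Real.exp (-M * t) * z x t ≤ Real.exp (-M * s) * z y s :=
    fun y hy s hs => hm (show (y, s) ∈ closure Ω ×ˢ Icc a b from ⟨hy, hs⟩)
  simp only at hx ht
  have hneg : z x t < 0 := by
    have h1 := hm' x₁ hx₁ t₁ ht₁
    have h2 := mul_neg_of_pos_of_neg (Real.exp_pos (-M * t₁)) hneg₁
    by_contra! h3
    have := mul_nonneg (Real.exp_pos (-M * t)).le h3
    linarith
  have hta : a < t := by
    rcases ht.1.eq_or_lt with h | h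
    · subst h
      exact absurd (hinit x hx) hneg.not_ge
    · exact h
  have hxΩ : x ∈ Ω := by
    by_contra hxΩ
    exact absurd (hbdry x (by rw [hΩ.frontier_eq]; exact ⟨hx, hxΩ⟩) t ⟨hta, ht.2⟩) hneg.not_ge
  have hspace : IsMinOn (fun y => z y t) (closure Ω) x := fun y hy =>
    le_of_mul_le_mul_left (hm' y hy t ht) (Real.exp_pos _)
  obtain ⟨d, hd, hMd⟩ := hmin x hxΩ t ⟨hta, ht.2⟩ hneg hspace
  -- `t` minimises `s ↦ exp (-M s) z x s` on `[a, t]`, so the derivative there is nonpositive.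
  have hder : HasDerivAt (fun s => Real.exp (-M * s) * z x s)
      (Real.exp (-M * t) * (d - M * z x t)) t := by
    have h := ((((hasDerivAt_id' t).const_mul (-M)).exp).fun_mul hd)
    exact h.congr_deriv (by ring)
  have hpos : 0 < Real.exp (-M * t) * (d - M * z x t) :=
    mul_pos (Real.exp_pos _) (by linarith)
  have hslope := (hasDerivAt_iff_tendsto_slope.1 hder).mono_left (nhdsLT_le_nhdsNE t)
  refine absurd (le_of_tendsto hslope ?_) hpos.not_ge
  filter_upwards [Ioo_mem_nhdsLT hta] with s hs
  rw [slope_def_field]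
  exact div_nonpos_of_nonneg_of_nonpos
    (sub_nonneg.2 (hm' x hx s ⟨hs.1.le, hs.2.le.trans ht.2⟩)) (sub_nonpos.2 hs.2.le)

/-! ### Monotonicity in time -/

theorem tangent_le_inv_one_sub_sq {a b : ℝ} (ha : a < 1) (hb : b < 1) :
    2 / (1 - a) ^ 3 * (b - a) ≤ 1 / (1 - b) ^ 2 - 1 / (1 - a) ^ 2 := by
  have hp : 0 < 1 - a := by linarith
  have hq : 0 < 1 - b := by linarith
  have h : 1 / (1 - b) ^ 2 - 1 / (1 - a) ^ 2 - 2 / (1 - a) ^ 3 * (b - a) =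
      (b - a) ^ 2 * ((1 - a) + 2 * (1 - b)) / ((1 - a) ^ 3 * (1 - b) ^ 2) := by
    field_simp
    ring
  have : 0 ≤ (b - a) ^ 2 * ((1 - a) + 2 * (1 - b)) / ((1 - a) ^ 3 * (1 - b) ^ 2) := by positivity
  linarith

namespace MEMS

variable {n : ℕ} {Ω : Set (EuclideanSpace ℝ (Fin n))} {lam P T : ℝ}
  {f u₀ : EuclideanSpace ℝ (Fin n) → ℝ} {u : EuclideanSpace ℝ (Fin n) → ℝ → ℝ}

namespace IsClassicalSolution

theorem hasDerivAt (hu : IsClassicalSolution Ω lam P f u₀ T u) {x : EuclideanSpace ℝ (Fin n)}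
    (hx : x ∈ closure Ω) {t : ℝ} (ht : t ∈ Ioo 0 T) : HasDerivAt (u x) (deriv (u x) t) t :=
  (hu.differentiableAt_time x hx t ht).hasDerivAt

theorem contDiffAt (hu : IsClassicalSolution Ω lam P f u₀ T u) (hΩ : IsOpen Ω)
    {x : EuclideanSpace ℝ (Fin n)} (hx : x ∈ Ω) {t : ℝ} (ht : t ∈ Ioo 0 T) :
    ContDiffAt ℝ 2 (fun y => u y t) x :=
  (hu.contDiffOn_space t ht).contDiffAt (mem_of_superset (hΩ.mem_nhds hx) subset_closure)

theorem continuousOn_comp (hu : IsClassicalSolution Ω lam P f u₀ T u)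
    {S : Set (EuclideanSpace ℝ (Fin n) × ℝ)} {τ : ℝ → ℝ} (hτ : Continuous τ)
    (hS : ∀ p ∈ S, p.1 ∈ closure Ω ∧ τ p.2 ∈ Ico 0 T) :
    ContinuousOn (fun p : EuclideanSpace ℝ (Fin n) × ℝ => u p.1 (τ p.2)) S :=
  hu.continuousOn.comp (f := fun p : EuclideanSpace ℝ (Fin n) × ℝ => (p.1, τ p.2))
    (by fun_prop) fun p hp => ⟨(hS p hp).1, (hS p hp).2⟩

theorem continuousOn_slice (hu : IsClassicalSolution Ω lam P f u₀ T u) {t : ℝ}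
    (ht : t ∈ Ico 0 T) : ContinuousOn (fun y => u y t) (closure Ω) :=
  hu.continuousOn.comp (f := fun y : EuclideanSpace ℝ (Fin n) => (y, t))
    (by fun_prop) fun _ hy => ⟨hy, ht⟩

theorem continuousOn_line (hu : IsClassicalSolution Ω lam P f u₀ T u)
    {x : EuclideanSpace ℝ (Fin n)} (hx : x ∈ closure Ω) : ContinuousOn (u x) (Ico 0 T) :=
  hu.continuousOn.comp (f := fun t : ℝ => (x, t)) (by fun_prop) fun _ ht => ⟨hx, ht⟩

/-- The boundary condition extends to the time `0` by continuity. -/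
theorem boundary_initial (hu : IsClassicalSolution Ω lam P f u₀ T u) (hT : 0 < T)
    {x : EuclideanSpace ℝ (Fin n)} (hx : x ∈ frontier Ω) : u x 0 = 0 := by
  have h1 := (hu.continuousOn_line (frontier_subset_closure hx)) 0 ⟨le_rfl, hT⟩
  have h2 : Tendsto (u x) (𝓝[>] 0) (𝓝 (u x 0)) := by
    rw [← nhdsWithin_Ioo_eq_nhdsGT hT]
    exact h1.mono_left (nhdsWithin_mono _ Ioo_subset_Ico_self)
  refine tendsto_nhds_unique h2 (tendsto_const_nhds.congr' ?_)
  filter_upwards [Ioo_mem_nhdsGT hT] with t ht using (hu.boundary x hx t ht).symm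

theorem deriv_eq (hu : IsClassicalSolution Ω lam P f u₀ T u) {x : EuclideanSpace ℝ (Fin n)}
    (hx : x ∈ Ω) {t : ℝ} (ht : t ∈ Ioo 0 T) :
    deriv (u x) t =
      Laplacian.laplacian (fun y => u y t) x + (lam * f x * (1 / (1 - u x t) ^ 2) + P) := by
  have := hu.equation x hx t ht
  rw [mul_one_div]
  linarith

/-- The coefficient of the linearised equation is bounded up to any time before `T`. -/
theorem exists_coefficient_lt (hu : IsClassicalSolution Ω lam P f u₀ T u)
    (hcomp : IsCompact (closure Ω)) (hf : ContinuousOn f (closure Ω)) {b : ℝ} (hb : b < T) :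
    ∃ M, ∀ x ∈ closure Ω, ∀ t ∈ Icc 0 b, lam * f x * (2 / (1 - u x t) ^ 3) < M := by
  have hcont : ContinuousOn (fun p : EuclideanSpace ℝ (Fin n) × ℝ =>
      lam * f p.1 * (2 / (1 - u p.1 p.2) ^ 3)) (closure Ω ×ˢ Icc 0 b) := by
    have h1 : ContinuousOn (fun p : EuclideanSpace ℝ (Fin n) × ℝ => u p.1 p.2)
        (closure Ω ×ˢ Icc 0 b) :=
      hu.continuousOn.mono fun p hp => ⟨hp.1, hp.2.1, hp.2.2.trans_lt hb⟩
    have h2 : ContinuousOn (fun p : EuclideanSpace ℝ (Fin n) × ℝ => f p.1)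
        (closure Ω ×ˢ Icc 0 b) := hf.comp continuousOn_fst fun p hp => hp.1
    refine (continuousOn_const.mul h2).mul (continuousOn_const.div
      ((continuousOn_const.sub h1).pow 3) fun p hp => ?_)
    have := hu.lt_one p.1 hp.1 p.2 ⟨hp.2.1, hp.2.2.trans_lt hb⟩
    exact pow_ne_zero _ (by linarith)
  obtain ⟨M, hM⟩ := (hcomp.prod isCompact_Icc).bddAbove_image hcont
  refine ⟨M + 1, fun x hx t ht => ?_⟩
  have := hM (mem_image_of_mem _ (show (x, t) ∈ closure Ω ×ˢ Icc 0 b from ⟨hx, ht⟩))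
  linarith

/-- The initial datum being a subsolution, the solution stays above it. -/
theorem initial_le (hu : IsClassicalSolution Ω lam P f u₀ T u) (hΩ : IsOpen Ω)
    (hcomp : IsCompact (closure Ω)) (hT : 0 < T) (hlam : 0 ≤ lam)
    (hf : ContinuousOn f (closure Ω)) (hf₀ : ∀ x ∈ closure Ω, 0 ≤ f x)
    (hu₀ : ContDiffOn ℝ 2 u₀ (closure Ω))
    (hsub : ∀ x ∈ Ω, 0 ≤ Laplacian.laplacian u₀ x + lam * f x / (1 - u₀ x) ^ 2 + P)
    {x : EuclideanSpace ℝ (Fin n)} (hx : x ∈ closure Ω) {b : ℝ} (hb : b ∈ Ico 0 T) :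
    u x 0 ≤ u x b := by
  obtain ⟨M, hM⟩ := hu.exists_coefficient_lt hcomp hf hb.2
  have hmem : ∀ {t}, t ∈ Icc 0 b → t ∈ Ico 0 T := fun ht => ⟨ht.1, ht.2.trans_lt hb.2⟩
  have key := nonneg_of_parabolic_minimum (z := fun x t => u x t - u x 0) (a := 0) (b := b)
    (M := M) hΩ hcomp ?_ ?_ ?_ ?_ x hx b ⟨hb.1, le_rfl⟩
  · simpa using key
  · exact (hu.continuousOn_comp continuous_id' fun p hp => ⟨hp.1, hmem hp.2⟩).sub
      (hu.continuousOn_comp continuous_const fun p hp => ⟨hp.1, le_rfl, hT⟩)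
  · intro y _
    simp
  · intro y hy t ht
    rw [hu.boundary y hy t ⟨ht.1, ht.2.trans_lt hb.2⟩, hu.boundary_initial hT hy, sub_zero]
  · intro y hy t ht hneg hmin
    have ht' : t ∈ Ioo 0 T := ⟨ht.1, ht.2.trans_lt hb.2⟩
    have hyc := subset_closure hy
    refine ⟨deriv (u y) t, (hu.hasDerivAt hyc ht').sub_const _, ?_⟩
    have hC0 : ContDiffAt ℝ 2 u₀ y :=
      hu₀.contDiffAt (mem_of_superset (hΩ.mem_nhds hy) subset_closure)
    have hC := hu.contDiffAt hΩ hy ht'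
    have hloc : IsLocalMin (fun y => u y t - u₀ y) y := by
      filter_upwards [hΩ.mem_nhds hy] with w hw
      have := hmin (subset_closure hw)
      simpa [← hu.initial w hw, ← hu.initial y hy] using this
    have hlap := laplacian_le_of_isLocalMin_sub hC hC0 hloc
    have h1 := hsub y hy
    have h2 := hu.deriv_eq hy ht'
    have h3 := tangent_le_inv_one_sub_sq (hu.lt_one y hyc 0 ⟨le_rfl, hT⟩)
      (hu.lt_one y hyc t ⟨ht'.1.le, ht'.2⟩)
    rw [← hu.initial y hy, ← mul_one_div] at h1
    have h4 := mul_le_mul_of_nonneg_left h3 (mul_nonneg hlam (hf₀ y hyc))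
    have h5 := mul_lt_mul_of_neg_right (hM y hyc 0 ⟨le_rfl, hb.1⟩) hneg
    nlinarith

/-- By convexity of `s ↦ (1 - s)⁻²`, the time increments of the solution are supersolutions of the
equation linearised at `u`. -/
theorem increment_supersolution (hu : IsClassicalSolution Ω lam P f u₀ T u) (hlam : 0 ≤ lam)
    (hf₀ : ∀ x ∈ closure Ω, 0 ≤ f x) {x : EuclideanSpace ℝ (Fin n)} (hx : x ∈ Ω) {t h : ℝ}
    (ht : t ∈ Ioo 0 T) (hth : t + h ∈ Ioo 0 T) :
    Laplacian.laplacian (fun y => u y (t + h)) x - Laplacian.laplacian (fun y => u y t) x +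
      lam * f x * (2 / (1 - u x t) ^ 3) * (u x (t + h) - u x t) ≤
        deriv (u x) (t + h) - deriv (u x) t := by
  have hxc := subset_closure hx
  have h1 := tangent_le_inv_one_sub_sq (hu.lt_one x hxc t ⟨ht.1.le, ht.2⟩)
    (hu.lt_one x hxc (t + h) ⟨hth.1.le, hth.2⟩)
  have h2 := mul_le_mul_of_nonneg_left h1 (mul_nonneg hlam (hf₀ x hxc))
  rw [hu.deriv_eq hx ht, hu.deriv_eq hx hth]
  linarith

theorem hasDerivAt_increment (hu : IsClassicalSolution Ω lam P f u₀ T u)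
    {x : EuclideanSpace ℝ (Fin n)} (hx : x ∈ closure Ω) {t h : ℝ}
    (ht : t ∈ Ioo 0 T) (hth : t + h ∈ Ioo 0 T) :
    HasDerivAt (fun s => u x (s + h) - u x s) (deriv (u x) (t + h) - deriv (u x) t) t :=
  ((hu.hasDerivAt hx hth).comp_add_const t h).sub (hu.hasDerivAt hx ht)

theorem continuousOn_increment (hu : IsClassicalSolution Ω lam P f u₀ T u) {a b h : ℝ}
    (ha : 0 ≤ a) (hh : 0 ≤ h) (hb : b + h < T) :
    ContinuousOn (fun p : EuclideanSpace ℝ (Fin n) × ℝ => u p.1 (p.2 + h) - u p.1 p.2)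
      (closure Ω ×ˢ Icc a b) := by
  refine (hu.continuousOn_comp (by fun_prop : Continuous fun t : ℝ => t + h) fun p hp =>
    ⟨hp.1, ?_, ?_⟩).sub (hu.continuousOn_comp continuous_id' fun p hp => ⟨hp.1, ?_, ?_⟩)
  all_goals have h1 := hp.2.1; have h2 := hp.2.2; linarith

/-- Solutions that start from a subsolution are nondecreasing in time. -/
theorem monotone_time (hu : IsClassicalSolution Ω lam P f u₀ T u) (hΩ : IsOpen Ω)
    (hcomp : IsCompact (closure Ω)) (hlam : 0 ≤ lam)
    (hf : ContinuousOn f (closure Ω)) (hf₀ : ∀ x ∈ closure Ω, 0 ≤ f x)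
    (hinit : ∀ x ∈ closure Ω, ∀ t ∈ Ico 0 T, u x 0 ≤ u x t)
    {x : EuclideanSpace ℝ (Fin n)} (hx : x ∈ closure Ω) : MonotoneOn (u x) (Ico 0 T) := by
  intro b hb t₁ ht₁ hle
  obtain ⟨h, hh, rfl⟩ : ∃ h, 0 ≤ h ∧ t₁ = b + h := ⟨t₁ - b, by linarith, by ring⟩
  obtain ⟨M, hM⟩ := hu.exists_coefficient_lt hcomp hf hb.2
  have key := nonneg_of_parabolic_minimum (z := fun x t => u x (t + h) - u x t) (a := 0) (b := b)
    (M := M) hΩ hcomp (hu.continuousOn_increment le_rfl hh ht₁.2) ?_ ?_ ?_ x hx b ⟨hb.1, le_rfl⟩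
  · simpa using key
  · intro y hy
    have := hinit y hy (0 + h) ⟨by linarith, by linarith [hb.1, ht₁.2]⟩
    linarith
  · intro y hy t ht
    have := ht₁.2
    rw [hu.boundary y hy t ⟨ht.1, ht.2.trans_lt hb.2⟩,
      hu.boundary y hy (t + h) ⟨by linarith [ht.1], by linarith [ht.2]⟩, sub_zero]
  · intro y hy t ht hneg hmin
    have ht' : t ∈ Ioo 0 T := ⟨ht.1, ht.2.trans_lt hb.2⟩
    have hth : t + h ∈ Ioo 0 T := ⟨by linarith [ht.1], by linarith [ht.2, ht₁.2]⟩
    have hyc := subset_closure hy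
    refine ⟨_, hu.hasDerivAt_increment hyc ht' hth, ?_⟩
    have hC := hu.contDiffAt hΩ hy ht'
    have hC' := hu.contDiffAt hΩ hy hth
    have hloc : IsLocalMin (fun y => u y (t + h) - u y t) y := by
      filter_upwards [hΩ.mem_nhds hy] with w hw using hmin (subset_closure hw)
    have hlap := laplacian_le_of_isLocalMin_sub hC' hC hloc
    have h1 := hu.increment_supersolution hlam hf₀ hy ht' hth
    have h2 := mul_lt_mul_of_neg_right (hM y hyc t ⟨ht.1.le, ht.2⟩) hneg
    linarith

end IsClassicalSolution

end MEMS

/-! ### Spreading of positivity for supersolutions of the heat equation -/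

/-- Quantitative spreading of positivity for a nonnegative supersolution `z` of the heat equation:
if `z ≥ m` on a ball at the time `a`, then `z ≥ m * exp (-α * (b - a))` at the time `b` at the
centre of every ball of the same radius that is reached by a translation with speed at most `V`.
The constant `α` depends only on the dimension, the radius and the speed. The comparison function
is the travelling bump `m R⁻⁴ exp (-α (t - a)) (R² - |x - ξ(t)|²)₊²`. -/
theorem le_of_heat_supersolution {E : Type*} [NormedAddCommGroup E] [InnerProductSpace ℝ E]
    [FiniteDimensional ℝ E] {Ω : Set E} (hΩ : IsOpen Ω) (hcomp : IsCompact (closure Ω))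
    (hconv : Convex ℝ Ω) {z : E → ℝ → ℝ} {a b R V α m : ℝ} (hab : a < b) (hR : 0 < R) (hV : 0 ≤ V)
    (hα : (8 + 4 * Module.finrank ℝ E + 4 * (R * V)) ^ 2 ≤ 32 * R ^ 2 * α) (hm : 0 < m)
    (hz : ContinuousOn (fun p : E × ℝ => z p.1 p.2) (closure Ω ×ˢ Icc a b))
    (hz₀ : ∀ x ∈ closure Ω, ∀ t ∈ Icc a b, 0 ≤ z x t)
    (hzC : ∀ x ∈ Ω, ∀ t ∈ Ioc a b, ContDiffAt ℝ 2 (fun y => z y t) x)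
    (hzsup : ∀ x ∈ Ω, ∀ t ∈ Ioc a b,
      ∃ d, HasDerivAt (z x) d t ∧ Laplacian.laplacian (fun y => z y t) x ≤ d)
    {x₀ y₀ : E} (hx₀ : Metric.ball x₀ R ⊆ Ω) (hy₀ : Metric.ball y₀ R ⊆ Ω)
    (hdist : ‖y₀ - x₀‖ ≤ V * (b - a)) (hzm : ∀ x ∈ Metric.ball x₀ R, m ≤ z x a) :
    m * Real.exp (-α * (b - a)) ≤ z y₀ b := by
  set N : ℝ := (Module.finrank ℝ E : ℝ)
  have hN : 0 ≤ N := Nat.cast_nonneg _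
  have hba : 0 < b - a := sub_pos.2 hab
  set v : E := (b - a)⁻¹ • (y₀ - x₀) with hv
  have hvV : ‖v‖ ≤ V := by
    rw [hv, norm_smul, norm_inv, Real.norm_of_nonneg hba.le, inv_mul_le_iff₀ hba]
    linarith
  set ξ : ℝ → E := fun t => x₀ + (t - a) • v with hξ
  have hξa : ξ a = x₀ := by simp [hξ]
  have hξb : ξ b = y₀ := by
    simp only [hξ, hv, smul_smul, mul_inv_cancel₀ hba.ne', one_smul]
    abel
  have hαpos : 0 < α := by
    by_contra! h
    have h1 : 0 < (8 + 4 * N + 4 * (R * V)) ^ 2 := by positivity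
    nlinarith [sq_nonneg R]
  have htube : ∀ t ∈ Icc a b, Metric.ball (ξ t) R ⊆ Ω := by
    intro t ht p hp
    have h1 : x₀ + (p - ξ t) ∈ Ω := hx₀ (by simpa [dist_eq_norm] using hp)
    have h2 : y₀ + (p - ξ t) ∈ Ω := hy₀ (by simpa [dist_eq_norm] using hp)
    have h3 := hconv.add_smul_sub_mem h1 h2
      (show (t - a) / (b - a) ∈ Icc (0 : ℝ) 1 from
        ⟨div_nonneg (by linarith [ht.1]) hba.le, (div_le_one hba).2 (by linarith [ht.2])⟩)
    have h4 : ((t - a) / (b - a)) • (y₀ + (p - ξ t) - (x₀ + (p - ξ t))) = (t - a) • v := by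
      rw [add_sub_add_right_eq_sub, hv, smul_smul, div_eq_mul_inv]
    rw [h4] at h3
    convert h3 using 1
    simp only [hξ]
    abel
  set s : E → ℝ → ℝ := fun x t => R ^ 2 - ‖x - ξ t‖ ^ 2 with hs
  have hscont : Continuous fun p : E × ℝ => s p.1 p.2 := by
    simp only [hs, hξ]
    fun_prop
  have hspos : ∀ x t, 0 < s x t → x ∈ Metric.ball (ξ t) R := by
    intro x t h
    rw [mem_ball_iff_norm]
    exact lt_of_pow_lt_pow_left₀ 2 hR.le (by simpa [hs] using h)
  set c : ℝ := m / R ^ 4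
  have hc : 0 < c := by positivity
  set ψ : E → ℝ → ℝ := fun x t => c * Real.exp (-α * (t - a)) * max (s x t) 0 ^ 2 with hψ
  have hψ0 : ∀ x t, s x t ≤ 0 → ψ x t = 0 := fun x t h => by simp [hψ, max_eq_right h]
  have key := nonneg_of_parabolic_minimum (z := fun x t => z x t - ψ x t) (a := a) (b := b)
    (M := 1) hΩ hcomp ?_ ?_ ?_ ?_ y₀ (subset_closure (hy₀ (Metric.mem_ball_self hR))) b
    ⟨hab.le, le_rfl⟩
  · have : ψ y₀ b = m * Real.exp (-α * (b - a)) := by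
      simp only [hψ, hs, hξb, sub_self, norm_zero, c]
      rw [max_eq_left (by nlinarith)]
      field_simp
      simp only [sub_zero, ne_eq, OfNat.ofNat_ne_zero, not_false_eq_true, zero_pow]
      ring
    linarith
  · refine hz.sub (Continuous.continuousOn ?_)
    simp only [hψ]
    fun_prop
  · intro x hx
    rcases le_or_gt (s x a) 0 with h | h
    · rw [hψ0 x a h, sub_zero]
      exact hz₀ x hx a ⟨le_rfl, hab.le⟩
    · have h1 := hzm x (hξa ▸ hspos x a h)
      have h2 : s x a ≤ R ^ 2 := by
        simp only [hs]
        linarith [sq_nonneg ‖x - ξ a‖]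
      have h3 : ψ x a ≤ m := by
        simp only [hψ, sub_self, mul_zero, Real.exp_zero, mul_one, max_eq_left h.le]
        calc c * s x a ^ 2 ≤ c * (R ^ 2) ^ 2 := by gcongr
          _ = m := by
            simp only [c]
            field_simp
      linarith
  · intro x hx t ht
    have h : s x t ≤ 0 := by
      by_contra! h
      have h1 := htube t ⟨ht.1.le, ht.2⟩ (hspos x t h)
      exact (hΩ.frontier_eq ▸ hx).2 h1
    rw [hψ0 x t h, sub_zero]
    exact hz₀ x (frontier_subset_closure hx) t ⟨ht.1.le, ht.2⟩
  · intro x hx t ht hneg hmin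
    have hst : 0 < s x t := by
      by_contra! h
      rw [hψ0 x t h, sub_zero] at hneg
      exact absurd (hz₀ x (subset_closure hx) t ⟨ht.1.le, ht.2⟩) hneg.not_ge
    set e := Real.exp (-α * (t - a)) with he
    have hce : 0 < c * e := mul_pos hc (Real.exp_pos _)
    set w := x - ξ t with hw
    obtain ⟨d, hd, hΔ⟩ := hzsup x hx t ht
    -- Near `x` the positive part in the bump can be dropped.
    have hCq : ContDiff ℝ 2 fun y : E => (R ^ 2 - ‖y - ξ t‖ ^ 2) ^ 2 :=
      (contDiff_const.sub ((contDiff_id.sub contDiff_const).norm_sq ℝ)).pow 2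
    have hpos_x : ∀ᶠ y in 𝓝 x, 0 < s y t :=
      (hscont.comp (by fun_prop : Continuous fun y : E => (y, t))).continuousAt.eventually
        (lt_mem_nhds hst)
    have hloc : IsLocalMin
        (fun y => z y t - c * e * (R ^ 2 - ‖y - ξ t‖ ^ 2) ^ 2) x := by
      filter_upwards [hΩ.mem_nhds hx, hpos_x] with y hy hsy
      have h1 := hmin (subset_closure hy)
      simpa only [hψ, mem_ofPred_eq, max_eq_left hsy.le, max_eq_left hst.le] using h1
    have hlap := laplacian_le_of_isLocalMin_sub (hzC x hx t ht)
      (contDiffAt_const.mul hCq.contDiffAt) hloc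
    rw [laplacian_const_mul _ hCq.contDiffAt, laplacian_sq_sub_norm_sq_sq] at hlap
    have hsder : HasDerivAt (s x) (2 * inner ℝ w v) t := by
      have h1 : HasDerivAt (fun t => x - ξ t) (-v) t := by
        have := (((hasDerivAt_id' t).sub_const a).smul_const v).const_add x₀ |>.const_sub x
        simpa using this
      exact (h1.norm_sq.const_sub (R ^ 2)).congr_deriv (by rw [inner_neg_right]; ring)
    have heder : HasDerivAt (fun t => c * Real.exp (-α * (t - a))) (c * (e * -α)) t := by
      have := ((((hasDerivAt_id' t).sub_const a).const_mul (-α)).exp).const_mul c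
      exact this.congr_deriv (by ring)
    have hψder : HasDerivAt (ψ x)
        (c * (e * -α) * s x t ^ 2 + c * e * (2 * s x t * (2 * inner ℝ w v))) t := by
      have h1 := heder.fun_mul (hsder.fun_pow 2)
      have h2 : ∀ᶠ τ in 𝓝 t, 0 < s x τ :=
        (hscont.comp (by fun_prop : Continuous fun τ : ℝ => (x, τ))).continuousAt.eventually
          (lt_mem_nhds hst)
      refine (h1.congr_of_eventuallyEq ?_).congr_deriv (by rw [← he]; norm_num)
      filter_upwards [h2] with τ hτ
      simp only [hψ, max_eq_left hτ.le]
    refine ⟨_, hd.sub hψder, ?_⟩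
    have hwR : ‖w‖ ^ 2 = R ^ 2 - s x t := by simp [hs, hw]
    have hin : inner ℝ w v ≤ R * V := by
      have h1 : ‖w‖ ≤ R := by
        have := hspos x t hst
        rw [mem_ball_iff_norm] at this
        exact this.le
      exact (real_inner_le_norm w v).trans (mul_le_mul h1 hvV (norm_nonneg _) hR.le)
    -- The bump is a subsolution, a quadratic in `s x t` with nonpositive discriminant.
    have hquad : 0 ≤ 8 * ‖w‖ ^ 2 - 4 * N * (R ^ 2 - ‖w‖ ^ 2) + α * s x t ^ 2
        - 4 * s x t * inner ℝ w v := by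
      rw [hwR]
      have h1 : s x t * inner ℝ w v ≤ s x t * (R * V) := mul_le_mul_of_nonneg_left hin hst.le
      have h2 : 0 ≤ α * s x t ^ 2 - (8 + 4 * N + 4 * (R * V)) * s x t + 8 * R ^ 2 := by
        have h3 := sq_nonneg (2 * α * s x t - (8 + 4 * N + 4 * (R * V)))
        by_contra! h4
        nlinarith [mul_neg_of_pos_of_neg hαpos h4]
      linarith
    have hfin := mul_nonneg hce.le hquad
    have : 0 ≤ d - (c * (e * -α) * s x t ^ 2 + c * e * (2 * s x t * (2 * inner ℝ w v))) := by
      linarith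
    linarith

/-! ### Positivity of the time increments -/

namespace MEMS

variable {n : ℕ} {Ω : Set (EuclideanSpace ℝ (Fin n))} {lam P T : ℝ}
  {f u₀ : EuclideanSpace ℝ (Fin n) → ℝ} {u : EuclideanSpace ℝ (Fin n) → ℝ → ℝ}

namespace IsClassicalSolution

/-- A solution that quenches is not stationary. -/
theorem exists_deriv_pos (hu : IsClassicalSolution Ω lam P f u₀ T u)
    (hcomp : IsCompact (closure Ω)) (hT : 0 < T) (hquench : QuenchesAt Ω u T) :
    ∃ x ∈ Ω, ∃ t ∈ Ioo 0 T, 0 < deriv (u x) t := by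
  have hne : (closure Ω).Nonempty := by
    obtain ⟨t, -, -, x, hx, -⟩ := hquench 1 one_pos 0 hT
    exact ⟨x, subset_closure hx⟩
  have hT2 : T / 2 ∈ Ico 0 T := ⟨by linarith, by linarith⟩
  obtain ⟨p, hp, hmax⟩ := hcomp.exists_isMaxOn hne (hu.continuousOn_slice hT2)
  obtain ⟨t, ht, hlt, x, hx, hux⟩ :=
    hquench (1 - u p (T / 2)) (sub_pos.2 (hu.lt_one p hp _ hT2)) (T / 2) hT2.2
  have hxc := subset_closure hx
  have h1 : u x (T / 2) < u x t := (hmax hxc).trans_lt (by linarith)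
  have hsub : Icc (T / 2) t ⊆ Ioo 0 T := fun s hs => ⟨by linarith [hs.1], hs.2.trans_lt ht.2⟩
  obtain ⟨s, hs, hs'⟩ := exists_deriv_eq_slope (u x) hlt
    (fun s hs => (hu.hasDerivAt hxc (hsub hs)).continuousAt.continuousWithinAt)
    (fun s hs => (hu.hasDerivAt hxc (hsub (Ioo_subset_Icc_self hs))).differentiableAt
      |>.differentiableWithinAt)
  refine ⟨x, hx, s, hsub (Ioo_subset_Icc_self hs), ?_⟩
  rw [hs']
  exact div_pos (by linarith) (by linarith)

/-- Time increments `u(·, t₀ + h) - u(·, t₀)` are at least of the order of `h` on compact subsets of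
`Ω`, once `u_t` has been positive somewhere. This replaces the strong maximum principle for `u_t`,
which is not known to be differentiable. -/
theorem exists_increment_ge (hu : IsClassicalSolution Ω lam P f u₀ T u) (hΩ : IsOpen Ω)
    (hcomp : IsCompact (closure Ω)) (hconv : Convex ℝ Ω) (hlam : 0 ≤ lam)
    (hf₀ : ∀ x ∈ closure Ω, 0 ≤ f x)
    (hmono : ∀ x ∈ closure Ω, MonotoneOn (u x) (Ico 0 T))
    {x₁ : EuclideanSpace ℝ (Fin n)} (hx₁ : x₁ ∈ Ω) {t₁ t₀ : ℝ} (ht₁ : t₁ ∈ Ioo 0 T)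
    (hpos : 0 < deriv (u x₁) t₁) (hlt : t₁ < t₀) (ht₀ : t₀ < T)
    {K : Set (EuclideanSpace ℝ (Fin n))} (hK : IsCompact K) (hKΩ : K ⊆ Ω) :
    ∃ m > 0, ∃ h₀ > 0, ∀ h, 0 < h → h < h₀ → ∀ y ∈ K, m * h ≤ u y (t₀ + h) - u y t₀ := by
  set m₁ := deriv (u x₁) t₁ / 2
  have hm₁ : 0 < m₁ := half_pos hpos
  have hnhds : closure Ω ×ˢ Ioo 0 T ∈ 𝓝 (x₁, t₁) := prod_mem_nhds
    (mem_of_superset (hΩ.mem_nhds hx₁) subset_closure) (isOpen_Ioo.mem_nhds ht₁)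
  have hev : ∀ᶠ p : EuclideanSpace ℝ (Fin n) × ℝ in 𝓝 (x₁, t₁), m₁ < deriv (u p.1) p.2 :=
    (hu.continuousOn_time_deriv.continuousAt hnhds).eventually (lt_mem_nhds (half_lt_self hpos))
  obtain ⟨δ, hδ, hball⟩ := Metric.eventually_nhds_iff_ball.1 hev
  obtain ⟨δ', hδ', hball'⟩ := Metric.isOpen_iff.1 hΩ x₁ hx₁
  obtain ⟨ρ, hρ, hthick⟩ := hK.exists_thickening_subset_open hΩ hKΩ
  obtain ⟨C, hC⟩ := hcomp.isBounded.subset_closedBall x₁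
  set R := min δ (min δ' ρ)
  have hR : 0 < R := lt_min hδ (lt_min hδ' hρ)
  have hba : 0 < t₀ - t₁ := sub_pos.2 hlt
  set V := C / (t₀ - t₁)
  have hC0 : 0 ≤ C := by
    have h1 := hC (subset_closure hx₁)
    rw [Metric.mem_closedBall] at h1
    exact dist_nonneg.trans h1
  have hV : 0 ≤ V := div_nonneg hC0 hba.le
  set N : ℝ := (Module.finrank ℝ (EuclideanSpace ℝ (Fin n)) : ℝ) with hN
  set α := (8 + 4 * N + 4 * (R * V)) ^ 2 / (32 * R ^ 2)
  have hα : (8 + 4 * N + 4 * (R * V)) ^ 2 ≤ 32 * R ^ 2 * α :=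
    (mul_div_cancel₀ _ (by positivity)).ge
  refine ⟨m₁ * Real.exp (-α * (t₀ - t₁)), by positivity, min δ (T - t₀),
    lt_min hδ (by linarith), fun h hh hh₀ y hy => ?_⟩
  have hhδ : h < δ := hh₀.trans_le (min_le_left _ _)
  have hhT : t₀ + h < T := by linarith [hh₀.trans_le (min_le_right _ _)]
  have hin : ∀ t ∈ Icc t₁ t₀, t ∈ Ioo 0 T ∧ t + h ∈ Ioo 0 T := fun t ht =>
    ⟨⟨by linarith [ht.1, ht₁.1], by linarith [ht.2]⟩,
      by linarith [ht.1, ht₁.1], by linarith [ht.2]⟩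
  have hW : ∀ x ∈ closure Ω, ∀ t ∈ Icc t₁ t₀, 0 ≤ u x (t + h) - u x t := fun x hx t ht =>
    sub_nonneg.2 (hmono x hx ⟨(hin t ht).1.1.le, (hin t ht).1.2⟩
      ⟨(hin t ht).2.1.le, (hin t ht).2.2⟩ (by linarith))
  have key := le_of_heat_supersolution (z := fun x t => u x (t + h) - u x t) (m := m₁ * h)
    (x₀ := x₁) (y₀ := y) hΩ hcomp hconv hlt hR hV hα (by positivity)
    (hu.continuousOn_increment ht₁.1.le hh.le hhT) hW ?_ ?_ ?_ ?_ ?_ ?_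
  · linarith
  · intro x hx t ht
    have ht' := hin t ⟨ht.1.le, ht.2⟩
    exact (hu.contDiffAt hΩ hx ht'.2).sub (hu.contDiffAt hΩ hx ht'.1)
  · intro x hx t ht
    have ht' := hin t ⟨ht.1.le, ht.2⟩
    have hxc := subset_closure hx
    refine ⟨_, hu.hasDerivAt_increment hxc ht'.1 ht'.2, ?_⟩
    have h1 := hu.increment_supersolution hlam hf₀ hx ht'.1 ht'.2
    have h2 : 0 ≤ lam * f x * (2 / (1 - u x t) ^ 3) * (u x (t + h) - u x t) := by
      have h3 : 0 < 1 - u x t := sub_pos.2 (hu.lt_one x hxc t ⟨ht'.1.1.le, ht'.1.2⟩)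
      exact mul_nonneg (mul_nonneg (mul_nonneg hlam (hf₀ x hxc)) (by positivity))
        (hW x hxc t ⟨ht.1.le, ht.2⟩)
    have h4 : Laplacian.laplacian (fun y => u y (t + h) - u y t) x =
        Laplacian.laplacian (fun y => u y (t + h)) x - Laplacian.laplacian (fun y => u y t) x :=
      (hu.contDiffAt hΩ hx ht'.2).laplacian_sub (hu.contDiffAt hΩ hx ht'.1)
    linarith
  · exact (Metric.ball_subset_ball ((min_le_right _ _).trans (min_le_left _ _))).trans hball'
  · refine (Metric.ball_subset_ball ((min_le_right _ _).trans (min_le_right _ _))).trans ?_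
    exact (Metric.ball_subset_thickening hy ρ).trans hthick
  · have h1 := hC (subset_closure (hKΩ hy))
    rw [mem_closedBall_iff_norm] at h1
    exact h1.trans (div_mul_cancel₀ C hba.ne').ge
  · intro x hx
    have hxδ : dist x x₁ < δ := (Metric.mem_ball.1 hx).trans_le (min_le_left _ _)
    have hxc : x ∈ closure Ω := subset_closure (hball' ((Metric.mem_ball.1 hx).trans_le
      ((min_le_right _ _).trans (min_le_left _ _))))
    have hseg : ∀ s ∈ Icc t₁ (t₁ + h), s ∈ Ioo 0 T := fun s hs =>
      ⟨by linarith [hs.1, ht₁.1], by linarith [hs.2]⟩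
    have h1 := (convex_Icc t₁ (t₁ + h)).mul_sub_le_image_sub_of_le_deriv (f := u x) (C := m₁)
      (fun s hs => (hu.hasDerivAt hxc (hseg s hs)).continuousAt.continuousWithinAt)
      (fun s hs => (hu.hasDerivAt hxc
        (hseg s (interior_subset hs))).differentiableAt.differentiableWithinAt)
      (fun s hs => (hball (x, s) (by
        rw [interior_Icc] at hs
        rw [Metric.mem_ball, Prod.dist_eq, max_lt_iff]
        refine ⟨hxδ, ?_⟩
        rw [Real.dist_eq, abs_of_pos (by linarith [hs.1])]
        linarith [hs.2])).le)
      t₁ ⟨le_rfl, by linarith⟩ (t₁ + h) ⟨by linarith, le_rfl⟩ (by linarith)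
    simpa using h1

end IsClassicalSolution

end MEMS

/-! ### The lower bound for the time derivative and the quenching rate -/

namespace MEMS

/-- The convex function of `u` to which `u_t` is compared: `(1 - s)⁻²`, which has the growth of the
nonlinearity, plus the lower order term `(1 - s)⁻¹`. -/
noncomputable def profile (s : ℝ) : ℝ := 1 / (1 - s) ^ 2 + 1 / (1 - s)

/-- The derivative of `profile`. -/
noncomputable def profileDeriv (s : ℝ) : ℝ := 2 / (1 - s) ^ 3 + 1 / (1 - s) ^ 2

theorem hasDerivAt_profile {s : ℝ} (hs : s < 1) : HasDerivAt profile (profileDeriv s) s := by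
  have h0 : 1 - s ≠ 0 := by linarith
  have h1 := (hasDerivAt_id' s).const_sub 1
  have h2 := ((h1.fun_pow 2).fun_inv (pow_ne_zero 2 h0)).fun_add (h1.fun_inv h0)
  have h3 : profile = fun s => ((1 - s) ^ 2)⁻¹ + (1 - s)⁻¹ := by
    funext s
    simp [profile]
  rw [h3]
  refine h2.congr_deriv ?_
  rw [profileDeriv]
  field_simp
  norm_num
  ring

theorem continuousOn_profile : ContinuousOn profile (Iio 1) :=
  fun _ hs => (hasDerivAt_profile hs).continuousAt.continuousWithinAt

theorem profileDeriv_pos {s : ℝ} (hs : s < 1) : 0 < profileDeriv s := by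
  have : 0 < 1 - s := by linarith
  rw [profileDeriv]
  positivity

theorem profile_tangent_le {a b : ℝ} (ha : a < 1) (hb : b < 1) :
    profileDeriv a * (b - a) ≤ profile b - profile a := by
  have hp : 0 < 1 - a := by linarith
  have hq : 0 < 1 - b := by linarith
  have h1 := tangent_le_inv_one_sub_sq ha hb
  have h2 : 1 / (1 - b) - 1 / (1 - a) - 1 / (1 - a) ^ 2 * (b - a) =
      (b - a) ^ 2 / ((1 - a) ^ 2 * (1 - b)) := by
    field_simp
    ring
  have h3 : 0 ≤ (b - a) ^ 2 / ((1 - a) ^ 2 * (1 - b)) := by positivity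
  simp only [profile, profileDeriv]
  linarith

theorem profile_le_of_le {s a : ℝ} (hsa : s ≤ a) (ha : a < 1) : profile s ≤ profile a := by
  have h := profile_tangent_le (hsa.trans_lt ha) ha
  have := mul_nonneg (profileDeriv_pos (hsa.trans_lt ha)).le (sub_nonneg.2 hsa)
  linarith

/-- The term `(1 - s)⁻¹` in the profile makes the left side coercive: for `r = (1 - s)⁻¹`, the
bracket equals `φ (r⁴ - 2 D r³) - P (2 r³ + r²)`, and a constant `κ` takes care of bounded `r`. -/
theorem exists_profile_inequality {c₀ F P : ℝ} (hc₀ : 0 < c₀) (hP : 0 ≤ P) :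
    ∃ κ > 0, ∀ φ ∈ Icc c₀ F, ∀ D ∈ Icc (0 : ℝ) 6, ∀ s ∈ Ico (0 : ℝ) 1,
      0 ≤ φ * (2 / (1 - s) ^ 3) * (profile s - D)
        - profileDeriv s * (φ * (1 / (1 - s) ^ 2) + P) + κ := by
  set r₁ := 12 + 3 * P / c₀
  have hr₁ : 12 ≤ r₁ := le_add_of_nonneg_right (by positivity)
  refine ⟨r₁ ^ 3 * (12 * max F 0 + 3 * P) + 1, by positivity, fun φ hφ D hD s hs => ?_⟩
  obtain ⟨r, hr, hrs⟩ : ∃ r, 1 ≤ r ∧ 1 / (1 - s) = r :=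
    ⟨_, (one_le_div (by linarith [hs.2])).2 (by linarith [hs.1]), rfl⟩
  have e2 : 1 / (1 - s) ^ 2 = r ^ 2 := by rw [← hrs, one_div_pow]
  have e3 : 2 / (1 - s) ^ 3 = 2 * r ^ 3 := by rw [← hrs, one_div_pow, mul_one_div]
  have hφ0 : 0 ≤ φ := hc₀.le.trans hφ.1
  have hφF : φ ≤ max F 0 := hφ.2.trans (le_max_left _ _)
  simp only [profile, profileDeriv, e2, e3, hrs]
  have h1 : r ^ 2 ≤ r ^ 3 := pow_le_pow_right₀ hr (by norm_num)
  have hr3 : 0 < r ^ 3 := by positivity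
  have h2 : r ^ 3 * (φ * (r - 12) - 3 * P) ≤
      φ * (2 * r ^ 3) * (r ^ 2 + r - D) - (2 * r ^ 3 + r ^ 2) * (φ * r ^ 2 + P) := by
    have h3 : 0 ≤ φ * r ^ 3 * (12 - 2 * D) :=
      mul_nonneg (by positivity) (by linarith [hD.2])
    have h4 : P * r ^ 2 ≤ P * r ^ 3 := mul_le_mul_of_nonneg_left h1 hP
    nlinarith
  rcases le_or_gt r₁ r with h | h
  · have h3 : 3 * P ≤ φ * (r - 12) := by
      calc 3 * P = c₀ * (3 * P / c₀) := by field_simp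
        _ ≤ φ * (r - 12) :=
          mul_le_mul hφ.1 (by simp only [r₁] at h; linarith) (by positivity) hφ0
    have h5 : 0 ≤ r ^ 3 * (φ * (r - 12) - 3 * P) := mul_nonneg hr3.le (by linarith)
    have h6 : 0 ≤ r₁ ^ 3 * (12 * max F 0 + 3 * P) := by positivity
    linarith
  · have h3 : r ^ 3 * (12 * φ + 3 * P) ≤ r₁ ^ 3 * (12 * max F 0 + 3 * P) := by gcongr
    have h4 : 0 ≤ r ^ 3 * (φ * r) := by positivity
    linarith

variable {n : ℕ} {Ω : Set (EuclideanSpace ℝ (Fin n))} {lam P T : ℝ}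
  {f u₀ : EuclideanSpace ℝ (Fin n) → ℝ} {u : EuclideanSpace ℝ (Fin n) → ℝ → ℝ}

namespace IsClassicalSolution

/-- The comparison behind the lower bound for `u_t`: if the increments over time steps `h` dominate
`h ε (profile u - 3)` at the time `t₀`, they dominate `h ε (profile u - 6)` until the time `T`. The
level that is subtracted moves from `3` to `6` with speed `κ`, and at level `3` and above the
comparison function is negative on the boundary, where `u = 0` and `profile 0 = 2`. -/
theorem increment_ge_profile (hu : IsClassicalSolution Ω lam P f u₀ T u) (hΩ : IsOpen Ω)
    (hcomp : IsCompact (closure Ω)) (hlam : 0 ≤ lam)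
    (hf : ContinuousOn f (closure Ω)) (hf₀ : ∀ x ∈ closure Ω, 0 ≤ f x)
    (hmono : ∀ x ∈ closure Ω, MonotoneOn (u x) (Ico 0 T))
    {κ : ℝ} (hκ : 0 < κ)
    (hprof : ∀ x ∈ Ω, ∀ D ∈ Icc (0 : ℝ) 6, ∀ s ∈ Ico (0 : ℝ) 1,
      0 ≤ lam * f x * (2 / (1 - s) ^ 3) * (profile s - D)
        - profileDeriv s * (lam * f x * (1 / (1 - s) ^ 2) + P) + κ)
    {t₀ b h ε : ℝ} (ht₀ : t₀ ∈ Ioo 0 T) (hκT : κ * (T - t₀) ≤ 3) (htb : t₀ ≤ b) (hh : 0 < h)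
    (hbh : b + h < T) (hε : 0 < ε)
    (hinit : ∀ y ∈ closure Ω, h * (ε * (profile (u y t₀) - 3)) ≤ u y (t₀ + h) - u y t₀)
    {x : EuclideanSpace ℝ (Fin n)} (hx : x ∈ closure Ω) :
    h * (ε * (profile (u x b) - 6)) ≤ u x (b + h) - u x b := by
  have hbT : b < T := by linarith
  have hhε : 0 < h * ε := mul_pos hh hε
  have hin : ∀ t ∈ Icc t₀ b, t ∈ Ioo 0 T ∧ t + h ∈ Ioo 0 T := fun t ht =>
    ⟨⟨by linarith [ht.1, ht₀.1], by linarith [ht.2]⟩,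
      by linarith [ht.1, ht₀.1], by linarith [ht.2]⟩
  have hW : ∀ x ∈ closure Ω, ∀ t ∈ Icc t₀ b, 0 ≤ u x (t + h) - u x t := fun x hx t ht =>
    sub_nonneg.2 (hmono x hx ⟨(hin t ht).1.1.le, (hin t ht).1.2⟩
      ⟨(hin t ht).2.1.le, (hin t ht).2.2⟩ (by linarith))
  have hlt1 : ∀ x ∈ closure Ω, ∀ t ∈ Icc t₀ b, u x t < 1 := fun x hx t ht =>
    hu.lt_one x hx t ⟨(hin t ht).1.1.le, (hin t ht).1.2⟩
  have hD : ∀ t ∈ Icc t₀ b, 3 ≤ 3 + κ * (t - t₀) ∧ 3 + κ * (t - t₀) ≤ 6 := by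
    intro t ht
    have h1 : 0 ≤ κ * (t - t₀) := mul_nonneg hκ.le (by linarith [ht.1])
    have h2 : κ * (t - t₀) ≤ κ * (T - t₀) :=
      mul_le_mul_of_nonneg_left (by linarith [ht.2]) hκ.le
    constructor <;> linarith
  have hprof0 : profile 0 = 2 := by norm_num [profile]
  obtain ⟨M, hM⟩ := hu.exists_coefficient_lt hcomp hf hbT
  have key := nonneg_of_parabolic_minimum
    (z := fun x t => u x (t + h) - u x t - h * ε * (profile (u x t) - (3 + κ * (t - t₀))))
    (a := t₀) (b := b) (M := M) hΩ hcomp ?_ ?_ ?_ ?_ x hx b ⟨htb, le_rfl⟩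
  · have h1 := mul_le_mul_of_nonneg_left (hD b ⟨htb, le_rfl⟩).2 hhε.le
    linarith
  · refine (hu.continuousOn_increment ht₀.1.le hh.le hbh).sub
      (continuousOn_const.mul (ContinuousOn.sub ?_ (by fun_prop)))
    have h1 : ContinuousOn (fun p : EuclideanSpace ℝ (Fin n) × ℝ => u p.1 p.2)
        (closure Ω ×ˢ Icc t₀ b) := hu.continuousOn.mono fun p hp =>
      ⟨hp.1, (hin p.2 hp.2).1.1.le, (hin p.2 hp.2).1.2⟩
    exact continuousOn_profile.comp h1 fun p hp => hlt1 p.1 hp.1 p.2 hp.2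
  · intro y hy
    have h1 := hinit y hy
    rw [sub_self, mul_zero, add_zero]
    linarith
  · intro y hy t ht
    have ht' := hin t ⟨ht.1.le, ht.2⟩
    have h1 := (hD t ⟨ht.1.le, ht.2⟩).1
    rw [hu.boundary y hy t ht'.1, hu.boundary y hy (t + h) ht'.2, hprof0]
    nlinarith
  · intro y hy t ht hneg hmin
    have htI : t ∈ Icc t₀ b := ⟨ht.1.le, ht.2⟩
    have ht' := hin t htI
    have hyc := subset_closure hy
    have hWy := hW y hyc t htI
    have hD' := hD t htI
    have hy1 := hlt1 y hyc t htI
    set D := 3 + κ * (t - t₀)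
    set q := profileDeriv (u y t)
    have hprofD : D < profile (u y t) := by
      by_contra! hle
      nlinarith
    have hupos : 0 ≤ u y t := by
      by_contra! hle
      have := profile_le_of_le hle.le one_pos
      linarith
    -- By convexity of the profile, the minimum is also one of the function in which the profile is
    -- replaced by its tangent; this spares the second order chain rule.
    have hloc : IsLocalMin (fun w => u w (t + h) - (1 + h * ε * q) * u w t) y := by
      filter_upwards [hΩ.mem_nhds hy] with w hw
      have hwc := subset_closure hw
      have h1 : u y (t + h) - u y t - h * ε * (profile (u y t) - D) ≤
        u w (t + h) - u w t - h * ε * (profile (u w t) - D) := hmin hwc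
      have h2 := mul_le_mul_of_nonneg_left
        (profile_tangent_le hy1 (hlt1 w hwc t htI)) hhε.le
      linarith
    have hC := hu.contDiffAt hΩ hy ht'.1
    have hlap := laplacian_le_of_isLocalMin_sub (hu.contDiffAt hΩ hy ht'.2)
      (contDiffAt_const.mul hC) hloc
    rw [laplacian_const_mul _ hC] at hlap
    have hder : HasDerivAt (fun t => h * ε * (profile (u y t) - (3 + κ * (t - t₀))))
        (h * ε * (q * deriv (u y) t - κ)) t := by
      have h1 := (hasDerivAt_profile hy1).comp t (hu.hasDerivAt hyc ht'.1)
      have h2 := (((hasDerivAt_id' t).sub_const t₀).const_mul κ).const_add 3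
      exact ((h1.fun_sub h2).const_mul (h * ε)).congr_deriv (by simp [q])
    refine ⟨_, (hu.hasDerivAt_increment hyc ht'.1 ht'.2).sub hder, ?_⟩
    have h1 := hu.increment_supersolution hlam hf₀ hy ht'.1 ht'.2
    have h2 := mul_lt_mul_of_neg_right (hM y hyc t ⟨ht'.1.1.le, ht.2⟩) hneg
    have h3 := mul_nonneg hhε.le
      (hprof y hy D ⟨by linarith, hD'.2⟩ (u y t) ⟨hupos, hy1⟩)
    have h4 := hu.deriv_eq hy ht'.1
    have h5 : h * ε * (q * deriv (u y) t - κ) = h * ε * q * Laplacian.laplacian (fun y => u y t) y +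
        h * ε * (q * (lam * f y * (1 / (1 - u y t) ^ 2) + P) - κ) := by
      rw [h4]
      ring
    rw [h5]
    linarith

/-- The time derivative controls the nonlinearity, up to the boundary and up to the quenching
time. -/
theorem exists_deriv_ge_profile (hu : IsClassicalSolution Ω lam P f u₀ T u) (hΩ : IsOpen Ω)
    (hcomp : IsCompact (closure Ω)) (hconv : Convex ℝ Ω) (hT : 0 < T) (hlam : 0 < lam)
    (hP : 0 ≤ P) {c₀ : ℝ} (hc₀ : 0 < c₀)
    (hf : ContinuousOn f (closure Ω)) (hf₀ : ∀ x ∈ closure Ω, c₀ ≤ f x)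
    (hmono : ∀ x ∈ closure Ω, MonotoneOn (u x) (Ico 0 T)) (hquench : QuenchesAt Ω u T) :
    ∃ t₀ ∈ Ioo 0 T, ∃ ε > 0, ∀ x ∈ Ω, ∀ t ∈ Ioo t₀ T,
      ε * (profile (u x t) - 6) ≤ deriv (u x) t := by
  have hf₀' : ∀ x ∈ closure Ω, 0 ≤ f x := fun x hx => hc₀.le.trans (hf₀ x hx)
  obtain ⟨x₁, hx₁, t₁, ht₁, hpos⟩ := hu.exists_deriv_pos hcomp hT hquench
  obtain ⟨F, hF⟩ := hcomp.bddAbove_image hf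
  obtain ⟨κ, hκ, hprof⟩ := exists_profile_inequality (F := lam * F) (mul_pos hlam hc₀) hP
  set t₀ := max ((t₁ + T) / 2) (T - 3 / κ)
  have ht₀T : t₀ < T := max_lt (by linarith [ht₁.2]) (by linarith [div_pos three_pos hκ])
  have ht₁₀ : t₁ < t₀ := lt_max_of_lt_left (by linarith [ht₁.2])
  have ht₀ : t₀ ∈ Ioo 0 T := ⟨ht₁.1.trans ht₁₀, ht₀T⟩
  have hκT : κ * (T - t₀) ≤ 3 := by
    have h1 : T - 3 / κ ≤ t₀ := le_max_right _ _
    calc κ * (T - t₀) ≤ κ * (3 / κ) := mul_le_mul_of_nonneg_left (by linarith) hκ.le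
      _ = 3 := by field_simp
  have ht₀' : t₀ ∈ Ico 0 T := ⟨ht₀.1.le, ht₀.2⟩
  have hslice := hu.continuousOn_slice ht₀'
  -- As `profile (1 / 10) < 3`, the initial comparison is only needed where `u ≥ 1 / 10`, a compact
  -- subset of `Ω`.
  set K := closure Ω ∩ (fun y => u y t₀) ⁻¹' Ici (1 / 10)
  have hK : IsCompact K :=
    hcomp.of_isClosed_subset (hslice.preimage_isClosed_of_isClosed isClosed_closure isClosed_Ici)
      inter_subset_left
  have hKΩ : K ⊆ Ω := by
    intro y hy
    by_contra hyΩ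
    have h1 := hu.boundary y (by rw [hΩ.frontier_eq]; exact ⟨hy.1, hyΩ⟩) t₀ ht₀
    have h2 : 1 / 10 ≤ u y t₀ := hy.2
    norm_num [h1] at h2
  obtain ⟨m, hm, h₀, hh₀, hinc⟩ := hu.exists_increment_ge hΩ hcomp hconv hlam.le hf₀' hmono hx₁
    ht₁ hpos ht₁₀ ht₀T hK hKΩ
  have hprofc : ContinuousOn (fun y => profile (u y t₀)) (closure Ω) :=
    continuousOn_profile.comp hslice fun y hy => hu.lt_one y hy t₀ ht₀'
  obtain ⟨B, hB⟩ := hcomp.bddAbove_image hprofc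
  set B' := max B 0 + 1
  have hB' : 0 < B' := by positivity
  set ε := m / B'
  have hε : 0 < ε := div_pos hm hB'
  refine ⟨t₀, ht₀, ε, hε, fun x hx t ht => ?_⟩
  have hxc := subset_closure hx
  have htT : t ∈ Ioo 0 T := ⟨ht₀.1.trans ht.1, ht.2⟩
  have hslope := (hasDerivAt_iff_tendsto_slope_zero.1 (hu.hasDerivAt hxc htT)).mono_left
    (nhdsGT_le_nhdsNE 0)
  refine ge_of_tendsto hslope ?_
  filter_upwards [Ioo_mem_nhdsGT (lt_min hh₀ (sub_pos.2 ht.2))] with h hh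
  have hhT : t + h < T := by linarith [hh.2.trans_le (min_le_right _ _)]
  rw [smul_eq_mul, le_inv_mul_iff₀ hh.1]
  refine hu.increment_ge_profile hΩ hcomp hlam.le hf hf₀' hmono hκ ?_ ht₀ hκT ht.1.le hh.1 hhT hε
    ?_ hxc
  · intro y hy D hD s hs
    exact hprof _ ⟨mul_le_mul_of_nonneg_left (hf₀ y (subset_closure hy)) hlam.le,
      mul_le_mul_of_nonneg_left (hF (mem_image_of_mem _ (subset_closure hy))) hlam.le⟩ D hD s hs
  · intro y hy
    rcases lt_or_ge (u y t₀) (1 / 10) with hlt | hge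
    · have h1 := profile_le_of_le hlt.le (by norm_num)
      have h2 : profile (1 / 10) ≤ 3 := by norm_num [profile]
      have h3 := hmono y hy ht₀' ⟨by linarith [ht₀.1, hh.1], by linarith [ht.1]⟩
        (show t₀ ≤ t₀ + h by linarith [hh.1])
      have h4 : h * (ε * (profile (u y t₀) - 3)) ≤ 0 :=
        mul_nonpos_of_nonneg_of_nonpos hh.1.le
          (mul_nonpos_of_nonneg_of_nonpos hε.le (by linarith))
      linarith
    · have h1 := hinc h hh.1 (hh.2.trans_le (min_le_left _ _)) y ⟨hy, hge⟩
      have h2 : profile (u y t₀) ≤ B := hB (mem_image_of_mem (fun y => profile (u y t₀)) hy)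
      have h3 : ε * (profile (u y t₀) - 3) ≤ m := by
        calc ε * (profile (u y t₀) - 3) ≤ ε * B' :=
              mul_le_mul_of_nonneg_left (by linarith [le_max_left B 0]) hε.le
          _ = m := div_mul_cancel₀ m hB'.ne'
      calc h * (ε * (profile (u y t₀) - 3)) ≤ h * m := mul_le_mul_of_nonneg_left h3 hh.1.le
        _ ≤ _ := by linarith

/-- The quenching rate: `1 - u` is at least of the order of `(T - t) ^ (1 / 3)`, uniformly in
`Ω`. -/
theorem exists_quenching_rate (hu : IsClassicalSolution Ω lam P f u₀ T u)
    (hmono : ∀ x ∈ closure Ω, MonotoneOn (u x) (Ico 0 T)) {t₀ ε : ℝ} (ht₀ : t₀ ∈ Ioo 0 T)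
    (hε : 0 < ε)
    (hder : ∀ x ∈ Ω, ∀ t ∈ Ioo t₀ T, ε * (profile (u x t) - 6) ≤ deriv (u x) t) :
    ∃ c > 0, ∀ x ∈ Ω, ∀ t ∈ Ioo t₀ T, c * (T - t) ≤ (1 - u x t) ^ 3 := by
  have hT : 0 < T := ht₀.1.trans ht₀.2
  refine ⟨min (3 * ε / 2) (1 / (64 * T)), by positivity, fun x hx t ht => ?_⟩
  have hxc := subset_closure hx
  have hTt : 0 < T - t := sub_pos.2 ht.2
  have htT : t ∈ Ico 0 T := ⟨(ht₀.1.trans ht.1).le, ht.2⟩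
  rcases le_or_gt (1 / 4) (1 - u x t) with h4 | h4
  · calc min (3 * ε / 2) (1 / (64 * T)) * (T - t) ≤ 1 / (64 * T) * T := by
          gcongr
          · exact min_le_right _ _
          · linarith [htT.1]
      _ = (1 / 4) ^ 3 := by
          field_simp
          norm_num
      _ ≤ (1 - u x t) ^ 3 := by gcongr
  · refine (mul_le_mul_of_nonneg_right (min_le_left _ _) hTt.le).trans ?_
    have hanti : AntitoneOn (fun s => (1 - u x s) ^ 3 + 3 * ε / 2 * s) (Ico t T) := by
      have hd : ∀ s ∈ Ioo t T, HasDerivAt (fun s => (1 - u x s) ^ 3 + 3 * ε / 2 * s)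
          (-3 * (1 - u x s) ^ 2 * deriv (u x) s + 3 * ε / 2) s := by
        intro s hs
        have hsT : s ∈ Ioo 0 T := ⟨htT.1.trans_lt hs.1, hs.2⟩
        have h1 := (((hu.hasDerivAt hxc hsT).const_sub 1).fun_pow 3).fun_add
          ((hasDerivAt_id' s).const_mul (3 * ε / 2))
        exact h1.congr_deriv (by norm_num)
      refine antitoneOn_of_deriv_nonpos (convex_Ico t T) ?_ ?_ ?_
      · have := (hu.continuousOn_line hxc).mono (Ico_subset_Ico_left htT.1)
        fun_prop
      · rw [interior_Ico]
        exact fun s hs => (hd s hs).differentiableAt.differentiableWithinAt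
      · rw [interior_Ico]
        intro s hs
        rw [(hd s hs).deriv]
        have hsT : s ∈ Ico 0 T := ⟨htT.1.trans hs.1.le, hs.2⟩
        have hp : 0 < 1 - u x s := sub_pos.2 (hu.lt_one x hxc s hsT)
        have hp4 : 1 - u x s < 1 / 4 := by
          have := hmono x hxc htT hsT hs.1.le
          linarith
        have h1 := mul_le_mul_of_nonneg_left (hder x hx s ⟨ht.1.trans hs.1, hs.2⟩)
          (sq_nonneg (1 - u x s))
        have h2 : (1 - u x s) ^ 2 * (ε * (profile (u x s) - 6)) =
            ε * (1 + (1 - u x s) - 6 * (1 - u x s) ^ 2) := by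
          rw [profile]
          field_simp
        have h3 : 1 / 2 ≤ 1 + (1 - u x s) - 6 * (1 - u x s) ^ 2 := by nlinarith
        have h4 := mul_le_mul_of_nonneg_left h3 hε.le
        linarith
    have hlim : Tendsto (fun s : ℝ => 3 * ε / 2 * (s - t)) (𝓝[<] T)
        (𝓝 (3 * ε / 2 * (T - t))) :=
      (Continuous.tendsto (by fun_prop) T).mono_left nhdsWithin_le_nhds
    refine le_of_tendsto hlim ?_
    filter_upwards [Ioo_mem_nhdsLT ht.2] with s hs
    have h1 : (1 - u x s) ^ 3 + 3 * ε / 2 * s ≤ (1 - u x t) ^ 3 + 3 * ε / 2 * t :=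
      hanti ⟨le_rfl, ht.2⟩ ⟨hs.1.le, hs.2⟩ hs.1.le
    have h2 : 0 < 1 - u x s := sub_pos.2 (hu.lt_one x hxc s ⟨htT.1.trans hs.1.le, hs.2⟩)
    have h3 : 0 < (1 - u x s) ^ 3 := by positivity
    linarith

end IsClassicalSolution

end MEMS

/-! ### The quenching set and the boundary -/

namespace MEMS

variable {n : ℕ} {Ω : Set (EuclideanSpace ℝ (Fin n))} {lam P T : ℝ}
  {f u₀ : EuclideanSpace ℝ (Fin n) → ℝ} {u : EuclideanSpace ℝ (Fin n) → ℝ → ℝ}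

theorem isClosed_quenchingSet : IsClosed (quenchingSet Ω u T) := by
  set A : Set (EuclideanSpace ℝ (Fin n) × ℝ × ℝ) :=
    (fun p : EuclideanSpace ℝ (Fin n) × ℝ => (p.1, p.2, u p.1 p.2)) '' (Ω ×ˢ Ioo 0 T)
  have h : quenchingSet Ω u T = (fun x => (x, T, (1 : ℝ))) ⁻¹' closure A := by
    ext x
    simp only [quenchingSet, mem_preimage, mem_closure_iff_seq_limit]
    constructor
    · rintro ⟨-, xs, ts, hmem, hxs, hts, hus⟩
      exact ⟨fun k => (xs k, ts k, u (xs k) (ts k)),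
        fun k => ⟨(xs k, ts k), ⟨(hmem k).1, (hmem k).2⟩, rfl⟩,
        hxs.prodMk_nhds (hts.prodMk_nhds hus)⟩
    · rintro ⟨p, hp, hlim⟩
      choose q hq hqp using hp
      have hx : Tendsto (fun k => (q k).1) atTop (𝓝 x) := by
        simpa [← hqp] using hlim.fst_nhds
      have ht : Tendsto (fun k => (q k).2) atTop (𝓝 T) := by
        simpa [← hqp] using hlim.snd_nhds.fst_nhds
      have hu : Tendsto (fun k => u (q k).1 (q k).2) atTop (𝓝 1) := by
        simpa [← hqp] using hlim.snd_nhds.snd_nhds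
      exact ⟨⟨fun k => (q k).1, fun k => (hq k).1, hx⟩, fun k => (q k).1, fun k => (q k).2,
        fun k => ⟨(hq k).1, (hq k).2⟩, hx, ht, hu⟩
  rw [h]
  exact isClosed_closure.preimage (by fun_prop)

namespace IsClassicalSolution

/-- Since `(T - t) ^ (-2 / 3)` is integrable, the quenching rate bounds the solution near a boundary
point `y₀` by `1 / 2` plus a multiple of the distance to a supporting hyperplane. -/
theorem exists_le_near_boundary (hu : IsClassicalSolution Ω lam P f u₀ T u) (hΩ : IsOpen Ω)
    (hcomp : IsCompact (closure Ω)) (hconv : Convex ℝ Ω) (hlam : 0 ≤ lam) (hP : 0 ≤ P)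
    (hf : ContinuousOn f (closure Ω)) {t₀ c : ℝ} (ht₀ : t₀ ∈ Ioo 0 T) (hc : 0 < c)
    (hrate : ∀ x ∈ Ω, ∀ t ∈ Ioo t₀ T, c * (T - t) ≤ (1 - u x t) ^ 3)
    {y₀ : EuclideanSpace ℝ (Fin n)} (hy₀ : y₀ ∉ Ω) :
    ∃ t₂ < T, ∃ C : ℝ, ∃ l : EuclideanSpace ℝ (Fin n) →L[ℝ] ℝ,
      ∀ x ∈ closure Ω, ∀ t ∈ Ico t₂ T, u x t ≤ 1 / 2 + C * (l y₀ - l x) := by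
  obtain ⟨l, hl⟩ := geometric_hahn_banach_open_point hconv hΩ hy₀
  obtain ⟨F, hF⟩ := hcomp.bddAbove_image hf
  set A := 3 * (lam * max F 0 * c ^ (-(2 / 3) : ℝ)) with hA
  have hA0 : 0 ≤ A := by positivity
  -- The total mass `A (T - s) ^ (1 / 3) + P (T - s)` of the source is at most `1 / 4`.
  obtain ⟨t₂, hmass, ht₂⟩ : ∃ t₂, A * (T - t₂) ^ (1 / 3 : ℝ) + P * (T - t₂) ≤ 1 / 4 ∧
      t₂ ∈ Ioo t₀ T := by
    have hlim : Tendsto (fun s : ℝ => A * (T - s) ^ (1 / 3 : ℝ) + P * (T - s)) (𝓝[<] T)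
        (𝓝 0) := by
      have hcont : Continuous fun s : ℝ => A * (T - s) ^ (1 / 3 : ℝ) + P * (T - s) :=
        (continuous_const.mul ((continuous_const.sub continuous_id).rpow_const
          fun _ => Or.inr (by norm_num))).add (by fun_prop)
      have h := hcont.tendsto T
      rw [sub_self, Real.zero_rpow (by norm_num), mul_zero, mul_zero, add_zero] at h
      exact h.mono_left nhdsWithin_le_nhds
    exact ((hlim.eventually (ge_mem_nhds (by norm_num))).and (Ioo_mem_nhdsLT ht₀.2)).exists
  have ht₂' : t₂ ∈ Ico 0 T := ⟨(ht₀.1.trans ht₂.1).le, ht₂.2⟩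
  have hl' : ∀ x ∈ closure Ω, l x ≤ l y₀ := fun x hx =>
    closure_minimal (fun a ha => (hl a ha).le) (isClosed_le l.continuous continuous_const) hx
  -- A multiple of the distance to the hyperplane lies above `u(·, t₂) - 1 / 4`, as `u` vanishes on
  -- the contact set.
  obtain ⟨C, hC0, hC⟩ : ∃ C : ℝ, 0 ≤ C ∧ ∀ x ∈ closure Ω, u x t₂ ≤ 1 / 4 + C * (l y₀ - l x) := by
    set K := closure Ω ∩ (fun y => u y t₂) ⁻¹' Ici (1 / 4)
    have hK : IsCompact K := hcomp.of_isClosed_subset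
      ((hu.continuousOn_slice ht₂').preimage_isClosed_of_isClosed isClosed_closure isClosed_Ici)
      inter_subset_left
    have hKΩ : K ⊆ Ω := by
      intro y hy
      by_contra hyΩ
      have h1 := hu.boundary y (by rw [hΩ.frontier_eq]; exact ⟨hy.1, hyΩ⟩) t₂
        ⟨ht₀.1.trans ht₂.1, ht₂.2⟩
      have h2 : 1 / 4 ≤ u y t₂ := hy.2
      norm_num [h1] at h2
    rcases K.eq_empty_or_nonempty with hKe | hKne
    · refine ⟨0, le_rfl, fun x hx => ?_⟩
      by_contra! hlt
      exact hKe.subset (⟨hx, by simp only [mem_preimage, mem_Ici]; linarith⟩ : x ∈ K)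
    · obtain ⟨p, hp, hpmin⟩ := hK.exists_isMinOn hKne
        (f := fun x => l y₀ - l x) (by fun_prop)
      have hδ : 0 < l y₀ - l p := sub_pos.2 (hl p (hKΩ hp))
      refine ⟨1 / (l y₀ - l p), by positivity, fun x hx => ?_⟩
      have hlx : 0 ≤ l y₀ - l x := sub_nonneg.2 (hl' x hx)
      rcases lt_or_ge (u x t₂) (1 / 4) with hlt | hge
      · have : 0 ≤ 1 / (l y₀ - l p) * (l y₀ - l x) := by positivity
        linarith
      · have h1 : l y₀ - l p ≤ l y₀ - l x := hpmin (⟨hx, hge⟩ : x ∈ K)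
        have h2 : 1 ≤ 1 / (l y₀ - l p) * (l y₀ - l x) := by
          rw [one_div, le_inv_mul_iff₀ hδ]
          linarith
        have h3 := hu.lt_one x hx t₂ ht₂'
        linarith
  refine ⟨t₂, ht₂.2, C, l, fun x hx t ht => ?_⟩
  set θ : ℝ → ℝ := fun s =>
    A * ((T - t₂) ^ (1 / 3 : ℝ) - (T - s) ^ (1 / 3 : ℝ)) + P * (s - t₂) with hθ
  have hθcont : Continuous θ := by
    have : Continuous fun s : ℝ => (T - s) ^ (1 / 3 : ℝ) :=
      (continuous_const.sub continuous_id).rpow_const fun _ => Or.inr (by norm_num)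
    simp only [hθ]
    fun_prop
  have hθder : ∀ s < T,
      HasDerivAt θ (lam * max F 0 * (c * (T - s)) ^ (-(2 / 3) : ℝ) + P) s := by
    intro s hs
    have hTs : 0 < T - s := sub_pos.2 hs
    have h1 := ((((hasDerivAt_id' s).const_sub T).rpow_const (p := 1 / 3)
      (Or.inl hTs.ne')).const_sub ((T - t₂) ^ (1 / 3 : ℝ))).const_mul A
    have h2 := ((hasDerivAt_id' s).sub_const t₂).const_mul P
    refine (h1.fun_add h2).congr_deriv ?_
    rw [Real.mul_rpow hc.le hTs.le, hA, show (1 / 3 - 1 : ℝ) = -(2 / 3) by norm_num]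
    ring
  have key := nonneg_of_parabolic_minimum
    (z := fun x s => θ s + 1 / 4 + C * (l y₀ - l x) - u x s) (a := t₂) (b := t) (M := 1)
    hΩ hcomp ?_ ?_ ?_ ?_ x hx t ⟨ht.1, le_rfl⟩
  · have h1 : θ t ≤ 1 / 4 := by
      have h2 : 0 ≤ (T - t) ^ (1 / 3 : ℝ) := Real.rpow_nonneg (by linarith [ht.2]) _
      have h3 := mul_nonneg hA0 h2
      have h4 := mul_nonneg hP (sub_nonneg.2 ht.2.le)
      simp only [hθ]
      linarith
    linarith
  · exact ContinuousOn.sub (by fun_prop) (hu.continuousOn_comp continuous_id' fun p hp =>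
      ⟨hp.1, ht₂'.1.trans hp.2.1, hp.2.2.trans_lt ht.2⟩)
  · intro y hy
    have h1 : θ t₂ = 0 := by simp [hθ]
    have h2 := hC y hy
    rw [h1]
    linarith
  · intro y hy s hs
    have hsT : s < T := hs.2.trans_lt ht.2
    rw [hu.boundary y hy s ⟨ht₂'.1.trans_lt hs.1, hsT⟩]
    have h1 := mul_nonneg hC0 (sub_nonneg.2 (hl' y (frontier_subset_closure hy)))
    have h2 : (T - s) ^ (1 / 3 : ℝ) ≤ (T - t₂) ^ (1 / 3 : ℝ) :=
      Real.rpow_le_rpow (by linarith) (by linarith [hs.1]) (by norm_num)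
    have h3 := mul_nonneg hA0 (sub_nonneg.2 h2)
    have h4 := mul_nonneg hP (sub_nonneg.2 hs.1.le)
    simp only [hθ]
    linarith
  · intro y hy s hs hneg hmin
    have hsT : s ∈ Ioo 0 T := ⟨ht₂'.1.trans_lt hs.1, hs.2.trans_lt ht.2⟩
    have hyc := subset_closure hy
    refine ⟨_, ((((hθder s hsT.2).add_const (1 / 4)).add_const (C * (l y₀ - l y))).sub
      (hu.hasDerivAt hyc hsT)), ?_⟩
    have hloc : IsLocalMin (fun w => (-(C • l)) w - u w s) y := by
      filter_upwards [hΩ.mem_nhds hy] with w hw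
      have h1 : θ s + 1 / 4 + C * (l y₀ - l y) - u y s ≤
        θ s + 1 / 4 + C * (l y₀ - l w) - u w s := hmin (subset_closure hw)
      simp only [neg_apply, smul_apply, smul_eq_mul]
      linarith
    have hlap := laplacian_le_of_isLocalMin_sub (-(C • l)).contDiff.contDiffAt
      (hu.contDiffAt hΩ hy hsT) hloc
    rw [laplacian_continuousLinearMap] at hlap
    have h1 := hu.deriv_eq hy hsT
    have hp : 0 < 1 - u y s := sub_pos.2 (hu.lt_one y hyc s ⟨hsT.1.le, hsT.2⟩)
    have hcs : 0 < c * (T - s) := mul_pos hc (sub_pos.2 hsT.2)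
    have h2 : 1 / (1 - u y s) ^ 2 ≤ (c * (T - s)) ^ (-(2 / 3) : ℝ) := by
      have h3 : ((1 - u y s) ^ 3) ^ (-(2 / 3) : ℝ) = 1 / (1 - u y s) ^ 2 := by
        rw [← Real.rpow_natCast, ← Real.rpow_mul hp.le, one_div, ← Real.rpow_natCast,
          ← Real.rpow_neg hp.le]
        norm_num
      rw [← h3]
      exact Real.rpow_le_rpow_of_nonpos hcs (hrate y hy s ⟨ht₂.1.trans hs.1, hsT.2⟩)
        (by norm_num)
    have h4 : lam * f y ≤ lam * max F 0 := mul_le_mul_of_nonneg_left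
      ((hF (mem_image_of_mem _ hyc)).trans (le_max_left _ _)) hlam
    have h5 : lam * f y * (1 / (1 - u y s) ^ 2) ≤
        lam * max F 0 * (c * (T - s)) ^ (-(2 / 3) : ℝ) :=
      mul_le_mul h4 h2 (by positivity) (by positivity)
    linarith

end IsClassicalSolution

end MEMS

theorem theorem1p4 {n : ℕ} (Ω : Set (EuclideanSpace ℝ (Fin n)))
    (hΩ_open : IsOpen Ω) (hΩ_bdd : Bornology.IsBounded Ω) (hΩ_convex : Convex ℝ Ω)
    (hΩ_smooth : MEMS.HasSmoothBoundary Ω)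
    (lam P c₀ T : ℝ) (hlam : 0 < lam) (hP : 0 ≤ P) (hc₀ : 0 < c₀) (hT : 0 < T)
    (f u₀ : EuclideanSpace ℝ (Fin n) → ℝ)
    (hf : ContDiffOn ℝ 2 f (closure Ω)) (hf_lower : ∀ x ∈ closure Ω, c₀ ≤ f x)
    (hf_normal : ∀ y ∈ frontier Ω, ∀ ν, MEMS.IsOutwardUnitNormal Ω y ν →
      fderivWithin ℝ f (closure Ω) y ν ≤ 0)
    (hu₀ : ContDiffOn ℝ 2 u₀ (closure Ω)) (hu₀_nonneg : ∀ x ∈ Ω, 0 ≤ u₀ x)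
    (hu₀_sub : ∀ x ∈ Ω,
      0 ≤ Laplacian.laplacian u₀ x + lam * f x / (1 - u₀ x) ^ 2 + P)
    (u : EuclideanSpace ℝ (Fin n) → ℝ → ℝ)
    (hu : MEMS.IsClassicalSolution Ω lam P f u₀ T u)
    (hquench : MEMS.QuenchesAt Ω u T) :
    IsCompact (MEMS.quenchingSet Ω u T) ∧ MEMS.quenchingSet Ω u T ⊆ Ω ∧
      ∀ y ∈ frontier Ω, y ∉ MEMS.quenchingSet Ω u T := by
  have hcomp : IsCompact (closure Ω) := hΩ_bdd.isCompact_closure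
  have hf₀ : ∀ x ∈ closure Ω, 0 ≤ f x := fun x hx => hc₀.le.trans (hf_lower x hx)
  have hfc := hf.continuousOn
  have hmono : ∀ x ∈ closure Ω, MonotoneOn (u x) (Ico 0 T) := fun x hx =>
    hu.monotone_time hΩ_open hcomp hlam.le hfc hf₀ (fun y hy t ht =>
      hu.initial_le hΩ_open hcomp hT hlam.le hfc hf₀ hu₀ hu₀_sub hy ht) hx
  obtain ⟨t₀, ht₀, ε, hε, hder⟩ := hu.exists_deriv_ge_profile hΩ_open hcomp hΩ_convex hT hlam hP
    hc₀ hfc hf_lower hmono hquench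
  obtain ⟨c, hc, hrate⟩ := hu.exists_quenching_rate hmono ht₀ hε hder
  have hsub : MEMS.quenchingSet Ω u T ⊆ Ω := by
    rintro y ⟨-, xs, ts, hmem, hxs, hts, hus⟩
    by_contra hyΩ
    obtain ⟨t₂, ht₂, C, l, hle⟩ := hu.exists_le_near_boundary hΩ_open hcomp hΩ_convex hlam.le hP
      hfc ht₀ hc hrate hyΩ
    have hlim : Tendsto (fun k => 1 / 2 + C * (l y - l (xs k))) atTop
        (𝓝 (1 / 2 + C * (l y - l y))) :=
      (((l.continuous.tendsto y).comp hxs).const_sub (l y)).const_mul C |>.const_add (1 / 2)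
    have hle' : ∀ᶠ k in atTop, u (xs k) (ts k) ≤ 1 / 2 + C * (l y - l (xs k)) := by
      filter_upwards [hts.eventually (lt_mem_nhds ht₂)] with k hk
      exact hle _ (subset_closure (hmem k).1) _ ⟨hk.le, (hmem k).2.2⟩
    have h1 := le_of_tendsto_of_tendsto hus hlim hle'
    norm_num at h1
  refine ⟨hcomp.of_isClosed_subset MEMS.isClosed_quenchingSet fun x hx => hx.1, hsub, ?_⟩
  intro y hy hyq
  exact (hΩ_open.frontier_eq ▸ hy).2 (hsub hyq)
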